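/- For $n\ge 1$ choose a permutation $p$ uniformly at random among the permutations of $\{1,\dots,n\}$ that avoid the pattern $(132)$, i.e. for which there are no $i<j<k$ with $p(i)<p(k)<p(j)$. Let $\mathrm{LIS}(p)$ be the length of the longest increasing subsequence of $p$. Then, as $n\to\infty$, $$\mathbb E[\mathrm{LIS}(p)]=\sqrt{\pi n}+O(n^{1/4}),\qquad \sigma(\mathrm{LIS}(p))=c_1\sqrt n+O(n^{1/4}),\qquad c_1=\sqrt{\pi\left(\frac{\pi}{3}-1\right)},$$ where $\sigma$ denotes the standard deviation. Moreover, for $X_n(p)=(\mathrm{LIS}(p)-\sqrt{\pi n})/\sqrt n$ and every real $\theta>-\sqrt\pi$, the following series converges absolutely and $$\lim_{n\to\infty}\mathrm{Prob}(X_n(p)\le\theta)=\sum_{t=-\infty}^{\infty}\bigl(1-2t^2(\theta+\sqrt\pi)^2\bigr)e^{-(\theta+\sqrt\pi)^2t^2}.$$ In particular, $X_n$ converges in distribution to the probability law on $[-\sqrt\pi,\infty)$ whose distribution function at each $\theta>-\sqrt\pi$ is this sum. All of these statements hold as well for the permutations that avoid $(213)$, i.e. for which there are no $i<j<k$ with $p(j)<p(i)<p(k)$.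 -/

import Mathlib

open MeasureTheory ProbabilityTheory Filter Asymptotics
open scoped Topology Real

namespace PatternLIS

/-- `p` contains the pattern `τ`: some entries of `p`, read from left to right, are in the same
relative order as the entries of `τ`. -/
def Contains {k n : ℕ} (τ : Equiv.Perm (Fin k)) (p : Equiv.Perm (Fin n)) : Prop :=
  ∃ i : Fin k → Fin n, StrictMono i ∧ ∀ a b, p (i a) < p (i b) ↔ τ a < τ b

/-- The set of permutations of `n` letters that avoid the pattern `τ`. -/
def avoiders {k : ℕ} (τ : Equiv.Perm (Fin k)) (n : ℕ) : Set (Equiv.Perm (Fin n)) :=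
  {p | ¬ Contains τ p}

/-- The pattern (132), with letters and positions numbered from `0`: `0 ↦ 0`, `1 ↦ 2`, `2 ↦ 1`. -/
def pattern132 : Equiv.Perm (Fin 3) := Equiv.swap 1 2

/-- The pattern (213), with letters and positions numbered from `0`: `0 ↦ 1`, `1 ↦ 0`, `2 ↦ 2`. -/
def pattern213 : Equiv.Perm (Fin 3) := Equiv.swap 0 1

open Classical in
/-- The length of the longest increasing subsequence of `p`, a subsequence being given by the set
of its positions. -/
noncomputable def lis {n : ℕ} (p : Equiv.Perm (Fin n)) : ℕ :=
  (Finset.univ.filter fun s : Finset (Fin n) => StrictMonoOn p s).sup Finset.card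

instance permMeasurableSpace (n : ℕ) : MeasurableSpace (Equiv.Perm (Fin n)) := ⊤

instance permDiscrete (n : ℕ) : DiscreteMeasurableSpace (Equiv.Perm (Fin n)) := ⟨fun _ => trivial⟩

/-- The uniform probability measure on the permutations of `n` letters that avoid `τ`. -/
noncomputable def unif {k : ℕ} (τ : Equiv.Perm (Fin k)) (n : ℕ) : Measure (Equiv.Perm (Fin n)) :=
  uniformOn (avoiders τ n)

theorem avoiders_nonempty (τ : Equiv.Perm (Fin 3)) (n : ℕ) : (avoiders τ n).Nonempty := by
  by_cases h : τ = 1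
  · subst h
    refine ⟨Fin.revPerm, ?_⟩
    rintro ⟨i, hi, h⟩
    have h1 : i 0 < i 1 := hi (by decide)
    have h2 := (h 0 1).2 (by decide)
    rw [Fin.revPerm_apply, Fin.revPerm_apply, Fin.rev_lt_rev] at h2
    exact lt_asymm h1 h2
  · refine ⟨1, ?_⟩
    rintro ⟨i, hi, h'⟩
    have hm : StrictMono τ := fun a b hab => (h' a b).1 (hi hab)
    have h01 : τ 0 < τ 1 := hm (by decide)
    have h12 : τ 1 < τ 2 := hm (by decide)
    apply h
    revert h01 h12
    clear hm h' hi h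
    revert τ
    decide

instance unif_isProbabilityMeasure (τ : Equiv.Perm (Fin 3)) (n : ℕ) :
    IsProbabilityMeasure (unif τ n) :=
  isProbabilityMeasure_uniformOn (Set.toFinite _) (avoiders_nonempty τ n)

/-- The mean of the length of the longest increasing subsequence over the avoiders of `τ`. -/
noncomputable def lisMean (τ : Equiv.Perm (Fin 3)) (n : ℕ) : ℝ :=
  ∫ p, (lis p : ℝ) ∂(unif τ n)

/-- The standard deviation of the length of the longest increasing subsequence over the avoiders
of `τ`. -/
noncomputable def lisSD (τ : Equiv.Perm (Fin 3)) (n : ℕ) : ℝ :=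
  √(variance (fun p => (lis p : ℝ)) (unif τ n))

/-- The normalized random variable `X_n = (LIS - √(π n)) / √n`. -/
noncomputable def normLIS (n : ℕ) (p : Equiv.Perm (Fin n)) : ℝ :=
  ((lis p : ℝ) - √(π * n)) / √(n : ℝ)

/-- The `t`-th term of the series for the limiting distribution function at `θ`. -/
noncomputable def thetaTerm (θ : ℝ) (t : ℤ) : ℝ :=
  (1 - 2 * (t : ℝ) ^ 2 * (θ + √π) ^ 2) * Real.exp (-((θ + √π) ^ 2 * (t : ℝ) ^ 2))

end PatternLIS

/-!
A `(213)`-avoider is the skew sum of a `(213)`-avoider `R` and a direct sum `1 ⊕ L`, and the longest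
increasing subsequence of this permutation is the larger of those of `R` and of `1 ⊕ L`. The
generating function of the avoiders with `LIS ≤ k` therefore satisfies the recursion of the Dyck
paths of height at most `k`, which the reflection principle counts by an alternating sum of binomial
coefficients over the multiples of `k + 2`. Divided by the Catalan number this becomes an exact
series for `P(LIS > k)`; its terms are second differences of binomial coefficients around the middle
of a row, and the Gaussian approximation of these turns the series into `limitTail ((k + 2) / √n)`,
with an error that is summable against powers of `k`. This gives the limiting distribution.

The first two moments are sums of `P(LIS > k)` over `k`, so up to the error they are Riemann sums
for the integrals of `limitTail x` and `2 * x * limitTail x` over `(0, ∞)`. Because `limitTail` is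
decreasing, these sums are squeezed between values of the primitives near `0`, which Jacobi's
inversion formula for the theta function evaluates. Reverse-complementation, which preserves `LIS`
and exchanges the two patterns, transfers everything to `(132)`.
-/

namespace PatternLIS

open Equiv

section Pattern

variable {k m n : ℕ}

theorem Contains.trans {τ : Perm (Fin k)} {q : Perm (Fin m)} {p : Perm (Fin n)} :
    Contains τ q → Contains q p → Contains τ p := by
  rintro ⟨i, hi, hiτ⟩ ⟨e, he, heq⟩
  exact ⟨e ∘ i, he.comp hi, fun a b => (heq _ _).trans (hiτ a b)⟩

theorem contains_of_range_subset {τ : Perm (Fin k)} {q : Perm (Fin m)} {p : Perm (Fin n)}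
    {e : Fin m → Fin n} (he : StrictMono e) (heq : ∀ a b, p (e a) < p (e b) ↔ q a < q b)
    {i : Fin k → Fin n} (hi : StrictMono i) (hiτ : ∀ a b, p (i a) < p (i b) ↔ τ a < τ b)
    (hie : ∀ a, i a ∈ Set.range e) : Contains τ q := by
  choose f hf using hie
  refine ⟨f, fun a b hab => ?_, fun a b => ?_⟩
  · rw [← he.lt_iff_lt, hf, hf]
    exact hi hab
  · rw [← heq, hf, hf, hiτ]

theorem contains_one_iff {p : Perm (Fin n)} :
    Contains (1 : Perm (Fin k)) p ↔ ∃ i : Fin k → Fin n, StrictMono i ∧ StrictMono (p ∘ i) :=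
  exists_congr fun _ => and_congr_right fun _ =>
    ⟨fun h _ _ hab => (h _ _).2 hab, fun h _ _ => h.lt_iff_lt⟩

theorem le_lis_iff {p : Perm (Fin n)} : k ≤ lis p ↔ Contains (1 : Perm (Fin k)) p := by
  rw [contains_one_iff]
  constructor
  · intro hk
    obtain ⟨s, hs, hcard⟩ := Finset.exists_mem_eq_sup
      (Finset.univ.filter fun s : Finset (Fin n) => StrictMonoOn p s)
      ⟨∅, by simp [StrictMonoOn]⟩ Finset.card
    obtain ⟨t, hts, rfl⟩ := Finset.exists_subset_card_eq (hk.trans hcard.le)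
    refine ⟨t.orderEmbOfFin rfl, (t.orderEmbOfFin rfl).strictMono, fun a b hab => ?_⟩
    exact (Finset.mem_filter.1 hs).2 (hts (t.orderEmbOfFin_mem rfl a))
      (hts (t.orderEmbOfFin_mem rfl b)) ((t.orderEmbOfFin rfl).strictMono hab)
  · rintro ⟨i, hi, hpi⟩
    have hmono : StrictMonoOn p (Finset.univ.map ⟨i, hi.injective⟩ : Finset (Fin n)) := by
      simp only [Finset.coe_map, Finset.coe_univ, Set.image_univ, Function.Embedding.coeFn_mk]
      rintro _ ⟨a, rfl⟩ _ ⟨b, rfl⟩ hab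
      exact hpi (hi.lt_iff_lt.1 hab)
    have hmem := Finset.mem_filter (s := Finset.univ) (p := fun s : Finset (Fin n) =>
      StrictMonoOn p s) |>.2 ⟨Finset.mem_univ _, hmono⟩
    simpa [lis] using Finset.le_sup (f := Finset.card) hmem

theorem lis_le_size (p : Perm (Fin n)) : lis p ≤ n := by
  obtain ⟨i, hi, -⟩ := le_lis_iff.1 (le_refl (lis p))
  simpa using Fintype.card_le_of_injective i hi.injective

end Pattern

section ReverseComplement

variable {k n : ℕ}

/-- The reverse-complement of a permutation: its word is read from right to left and each letter
`a` is replaced by the opposite letter. -/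
def revComp (p : Perm (Fin n)) : Perm (Fin n) := Fin.revPerm.permCongr p

theorem revComp_apply (p : Perm (Fin n)) (x : Fin n) : revComp p x = (p x.rev).rev := by
  simp [revComp]

theorem revComp_involutive : Function.Involutive (revComp (n := n)) := fun p => by
  ext x
  simp [revComp_apply]

theorem Contains.revComp {τ : Perm (Fin k)} {p : Perm (Fin n)} :
    Contains τ p → Contains (revComp τ) (revComp p) := by
  rintro ⟨i, hi, hiτ⟩
  refine ⟨fun a => (i a.rev).rev, fun a b hab => ?_, fun a b => ?_⟩
  · simpa using hi (Fin.rev_lt_rev.2 hab)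
  · simp [revComp_apply, hiτ]

theorem contains_revComp_iff {τ : Perm (Fin k)} {p : Perm (Fin n)} :
    Contains (revComp τ) p ↔ Contains τ (revComp p) :=
  ⟨fun h => by simpa only [revComp_involutive τ] using h.revComp,
    fun h => by simpa only [revComp_involutive p] using h.revComp⟩

theorem lis_revComp (p : Perm (Fin n)) : lis (revComp p) = lis p := by
  refine eq_of_forall_le_iff fun k => ?_
  have hone : revComp (1 : Perm (Fin k)) = 1 := by
    ext x
    simp [revComp_apply]
  rw [le_lis_iff, le_lis_iff, ← contains_revComp_iff, hone]

theorem revComp_pattern132 : revComp pattern132 = pattern213 := by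
  ext x
  fin_cases x <;> rfl

end ReverseComplement

section Sum

variable {k i j n : ℕ}

/-- The arrangement of two blocks in which the first block comes after the second. -/
def blockSwap (i j : ℕ) : Fin i ⊕ Fin j ≃ Fin (i + j) :=
  (sumComm _ _).trans (finSumFinEquiv.trans (finCongr (add_comm j i)))

/-- The skew sum of two permutations: the word of `L`, with its letters raised above those of `R`,
followed by the word of `R`. -/
def skewSum (L : Perm (Fin i)) (R : Perm (Fin j)) : Perm (Fin (i + j)) :=
  finSumFinEquiv.symm.trans ((L.sumCongr R).trans (blockSwap i j))

theorem val_skewSum_castAdd (L : Perm (Fin i)) (R : Perm (Fin j)) (a : Fin i) :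
    (skewSum L R (a.castAdd j)).1 = j + L a := by
  simp [skewSum, blockSwap, add_comm]

theorem val_skewSum_natAdd (L : Perm (Fin i)) (R : Perm (Fin j)) (b : Fin j) :
    (skewSum L R (b.natAdd i)).1 = R b := by
  simp [skewSum, blockSwap]

theorem skewSum_injective2 : Function.Injective2 (skewSum (i := i) (j := j)) := by
  intro L L' R R' h
  have hsum : L.sumCongr R = L'.sumCongr R' := by
    ext x : 1
    simpa [skewSum] using DFunLike.congr_fun h (finSumFinEquiv x)
  exact Prod.mk.inj (Perm.sumCongrHom_injective (a₁ := (L, R)) (a₂ := (L', R')) hsum)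

theorem exists_eq_skewSum {p : Perm (Fin (i + j))}
    (hp : ∀ a b, p (Fin.natAdd i b) < p (Fin.castAdd j a)) : ∃ L R, skewSum L R = p := by
  have hle (a : Fin i) : j ≤ p (a.castAdd j) := by
    have hsub : Finset.univ.map ((Fin.natAddEmb i).trans p.toEmbedding) ⊆
        Finset.Iio (p (a.castAdd j)) := fun x hx => by
      obtain ⟨b, -, rfl⟩ := Finset.mem_map.1 hx
      exact Finset.mem_Iio.2 (hp a b)
    simpa using Finset.card_le_card hsub
  have hmaps : Set.MapsTo (finSumFinEquiv.trans (p.trans (blockSwap i j).symm))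
      (Set.range Sum.inl) (Set.range Sum.inl) := by
    rintro _ ⟨a, rfl⟩
    have hja := hle a
    refine ⟨⟨p (a.castAdd j) - j, by omega⟩, (blockSwap i j).injective (Fin.ext ?_)⟩
    simp [blockSwap, hja]
  obtain ⟨⟨L, R⟩, hLR⟩ := Perm.mem_sumCongrHom_range_of_perm_mapsTo_inl hmaps
  refine ⟨L, R, ?_⟩
  have hsum : L.sumCongr R = finSumFinEquiv.trans (p.trans (blockSwap i j).symm) := hLR
  rw [skewSum, hsum]
  ext x
  simp

theorem contains_skewSum_iff {τ : Perm (Fin (k + 1))} (hτ : τ 0 ≤ τ (Fin.last k))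
    {L : Perm (Fin i)} {R : Perm (Fin j)} :
    Contains τ (skewSum L R) ↔ Contains τ L ∨ Contains τ R := by
  have hL (a b) : skewSum L R (Fin.castAdd j a) < skewSum L R (Fin.castAdd j b) ↔ L a < L b := by
    simp only [Fin.lt_def, val_skewSum_castAdd, add_lt_add_iff_left]
  have hR (a b) : skewSum L R (Fin.natAdd i a) < skewSum L R (Fin.natAdd i b) ↔ R a < R b := by
    simp only [Fin.lt_def, val_skewSum_natAdd]
  constructor
  · rintro ⟨f, hf, hfτ⟩
    by_cases hlast : (f (Fin.last k)).1 < i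
    · refine Or.inl (contains_of_range_subset (Fin.strictMono_castAdd j) hL hf hfτ fun a => ?_)
      exact ⟨⟨f a, Nat.lt_of_le_of_lt (hf.monotone (Fin.le_last a)) hlast⟩, rfl⟩
    by_cases hzero : i ≤ (f 0).1
    · refine Or.inr (contains_of_range_subset (Fin.strictMono_natAdd i) hR hf hfτ fun a => ?_)
      have ha : i ≤ (f a).1 := hzero.trans (hf.monotone (Fin.zero_le a))
      exact ⟨⟨f a - i, by omega⟩, Fin.ext (Nat.add_sub_cancel' ha)⟩
    · obtain ⟨a, ha⟩ : ∃ a, Fin.castAdd j a = f 0 := ⟨⟨f 0, not_le.1 hzero⟩, rfl⟩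
      obtain ⟨b, hb⟩ : ∃ b, Fin.natAdd i b = f (Fin.last k) :=
        ⟨⟨f (Fin.last k) - i, by omega⟩, Fin.ext (Nat.add_sub_cancel' (not_lt.1 hlast))⟩
      refine absurd ((hfτ (Fin.last k) 0).1 ?_) hτ.not_gt
      rw [← ha, ← hb, Fin.lt_def, val_skewSum_castAdd, val_skewSum_natAdd]
      omega
  · rintro (h | h)
    · exact h.trans ⟨_, Fin.strictMono_castAdd j, hL⟩
    · exact h.trans ⟨_, Fin.strictMono_natAdd i, hR⟩

theorem lis_skewSum (L : Perm (Fin i)) (R : Perm (Fin j)) :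
    lis (skewSum L R) = max (lis L) (lis R) := by
  refine eq_of_forall_le_iff fun k => ?_
  cases k with
  | zero => simp
  | succ k =>
    rw [le_max_iff, le_lis_iff, le_lis_iff, le_lis_iff]
    exact contains_skewSum_iff (Fin.le_last _)

/-- The direct sum `1 ⊕ L`: the smallest letter, followed by the word of `L` raised by one. -/
def oneSum (L : Perm (Fin n)) : Perm (Fin (n + 1)) := Perm.decomposeFin.symm (0, L)

@[simp]
theorem oneSum_zero (L : Perm (Fin n)) : oneSum L 0 = 0 :=
  Perm.decomposeFin_symm_apply_zero 0 L

@[simp]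
theorem oneSum_succ (L : Perm (Fin n)) (x : Fin n) : oneSum L x.succ = (L x).succ := by
  simp [oneSum]

theorem oneSum_one : oneSum (1 : Perm (Fin n)) = 1 :=
  (Perm.decomposeFin_symm_of_one 0).trans (swap_self 0)

theorem oneSum_injective : Function.Injective (oneSum (n := n)) := fun _ _ h =>
  (Prod.mk.inj (Perm.decomposeFin.symm.injective h)).2

theorem exists_eq_oneSum {p : Perm (Fin (n + 1))} (hp : p 0 = 0) : ∃ L, oneSum L = p := by
  obtain ⟨⟨x, L⟩, rfl⟩ := Perm.decomposeFin.symm.surjective p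
  rw [Perm.decomposeFin_symm_apply_zero] at hp
  exact ⟨L, by rw [oneSum, hp]⟩

theorem contains_oneSum_iff {τ : Perm (Fin (k + 1))} (hτ : τ 0 ≠ 0) {L : Perm (Fin n)} :
    Contains τ (oneSum L) ↔ Contains τ L := by
  refine ⟨?_, fun h => h.trans ⟨_, Fin.strictMono_succ, by simp⟩⟩
  rintro ⟨f, hf, hfτ⟩
  refine contains_of_range_subset Fin.strictMono_succ (by simp) hf hfτ fun a => ?_
  rw [Fin.range_succ, Set.mem_compl_singleton_iff]
  intro ha
  have hzero : f 0 = 0 := Fin.le_zero_iff.1 (ha ▸ hf.monotone (Fin.zero_le a))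
  have hlt := (hfτ (τ.symm 0) 0).2 (by simpa [Fin.pos_iff_ne_zero] using hτ)
  rw [hzero, oneSum_zero] at hlt
  exact Fin.not_lt_zero _ hlt

theorem contains_oneSum_oneSum_iff {τ : Perm (Fin k)} {L : Perm (Fin n)} :
    Contains (oneSum τ) (oneSum L) ↔ Contains τ L := by
  constructor
  · rintro ⟨f, hf, hfτ⟩
    refine contains_of_range_subset Fin.strictMono_succ (by simp) (hf.comp Fin.strictMono_succ)
      (fun a b => (hfτ _ _).trans (by simp)) fun a => ?_
    rw [Fin.range_succ, Set.mem_compl_singleton_iff]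
    exact ((Fin.zero_le _).trans_lt (hf (Fin.succ_pos a))).ne'
  · rintro ⟨f, hf, hfτ⟩
    refine ⟨Fin.cons 0 (Fin.succ ∘ f), ?_, fun a b => ?_⟩
    · exact Fin.strictMono_cons.2 ⟨fun a => Fin.succ_pos _, Fin.strictMono_succ.comp hf⟩
    · cases a using Fin.cases <;> cases b using Fin.cases <;> simp [hfτ]

theorem lis_oneSum (L : Perm (Fin n)) : lis (oneSum L) = lis L + 1 := by
  refine eq_of_forall_le_iff fun k => ?_
  cases k with
  | zero => simp
  | succ k => rw [le_lis_iff, ← oneSum_one, contains_oneSum_oneSum_iff, ← le_lis_iff,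
      Nat.succ_le_succ_iff]

end Sum

section Counting

variable {k i j n : ℕ}

/-- The permutations of `n` letters that avoid `τ` and have no increasing subsequence of length
more than `m`. -/
def avoidersLe (τ : Perm (Fin k)) (n m : ℕ) : Set (Perm (Fin n)) :=
  {p | p ∈ avoiders τ n ∧ lis p ≤ m}

/-- The number of permutations of `n` letters that avoid `τ` and have no increasing subsequence
of length more than `m`. -/
noncomputable def numLe (τ : Perm (Fin k)) (n m : ℕ) : ℕ := (avoidersLe τ n m).ncard

theorem numLe_revComp (τ : Perm (Fin k)) (n m : ℕ) : numLe (revComp τ) n m = numLe τ n m := by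
  have himage : avoidersLe (revComp τ) n m = revComp '' avoidersLe τ n m := by
    rw [revComp_involutive.image_eq_preimage_symm]
    ext p
    simp [avoidersLe, avoiders, contains_revComp_iff, lis_revComp]
  rw [numLe, himage, Set.ncard_image_of_injective _ revComp_involutive.injective, numLe]

theorem skewSum_oneSum_natAdd_zero (R : Perm (Fin i)) (L : Perm (Fin j)) :
    skewSum R (oneSum L) (Fin.natAdd i 0) = 0 :=
  Fin.ext (by simp [val_skewSum_natAdd])

theorem skewSum_oneSum_mem_avoidersLe_iff {R : Perm (Fin i)} {L : Perm (Fin j)} {m : ℕ} :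
    skewSum R (oneSum L) ∈ avoidersLe pattern213 (i + (j + 1)) (m + 1) ↔
      R ∈ avoidersLe pattern213 i (m + 1) ∧ L ∈ avoidersLe pattern213 j m := by
  have hskew := contains_skewSum_iff (τ := pattern213) (by decide) (L := R) (R := oneSum L)
  have hone := contains_oneSum_iff (τ := pattern213) (by decide) (L := L)
  simp only [avoidersLe, avoiders, Set.mem_ofPred_eq, hskew, hone, lis_skewSum, lis_oneSum]
  grind

theorem not_mem_avoiders_pattern213 {p : Perm (Fin n)} {a b c : Fin n} (hab : a < b) (hbc : b < c)
    (hba : p b < p a) (hac : p a < p c) : p ∉ avoiders pattern213 n := by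
  have hbc' := hba.trans hac
  refine not_not.2 ⟨![a, b, c], Fin.strictMono_iff_lt_succ.2 fun x => ?_, fun x y => ?_⟩
  · fin_cases x <;> assumption
  · fin_cases x <;> fin_cases y <;>
      simp [pattern213, swap_apply_def, hac, hba, hbc', hba.le, hac.le, hbc'.le]

/-- Everything after the smallest letter lies below everything before it. -/
theorem exists_eq_skewSum_oneSum {p : Perm (Fin (i + (j + 1)))}
    (hp : p ∈ avoiders pattern213 (i + (j + 1))) (hzero : p (Fin.natAdd i 0) = 0) :
    ∃ R L, skewSum R (oneSum L) = p := by
  have hpos {x} (hx : x ≠ Fin.natAdd i 0) : p (Fin.natAdd i 0) < p x := by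
    rw [hzero, Fin.pos_iff_ne_zero, ← hzero]
    exact p.injective.ne hx
  have hblock (a : Fin i) (b : Fin (j + 1)) : p (b.natAdd i) < p (a.castAdd (j + 1)) := by
    have ha : a.castAdd (j + 1) < Fin.natAdd i 0 := by simp [Fin.lt_def]
    by_contra! hle
    rcases eq_or_ne b 0 with rfl | hb
    · exact hle.not_gt (hpos ha.ne)
    · refine not_mem_avoiders_pattern213 ha (Fin.strictMono_natAdd i (Fin.pos_iff_ne_zero.2 hb))
        (hpos ha.ne) (hle.lt_of_ne (p.injective.ne ?_)) hp
      exact (ha.trans_le ((Fin.strictMono_natAdd i).monotone (Fin.zero_le b))).ne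
  obtain ⟨R, S, rfl⟩ := exists_eq_skewSum hblock
  obtain ⟨L, rfl⟩ := exists_eq_oneSum (p := S) (Fin.ext (by
    simpa [val_skewSum_natAdd] using congr_arg Fin.val hzero))
  exact ⟨R, L, rfl⟩

theorem ncard_avoidersLe_of_apply_eq_zero (i j m : ℕ) :
    {p ∈ avoidersLe pattern213 (i + (j + 1)) (m + 1) | p (Fin.natAdd i 0) = 0}.ncard =
      numLe pattern213 i (m + 1) * numLe pattern213 j m := by
  have himage : {p ∈ avoidersLe pattern213 (i + (j + 1)) (m + 1) | p (Fin.natAdd i 0) = 0} =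
      (fun q : Perm (Fin i) × Perm (Fin j) => skewSum q.1 (oneSum q.2)) ''
        (avoidersLe pattern213 i (m + 1) ×ˢ avoidersLe pattern213 j m) := by
    ext p
    constructor
    · rintro ⟨hp, hzero⟩
      obtain ⟨R, L, rfl⟩ := exists_eq_skewSum_oneSum hp.1 hzero
      exact ⟨(R, L), skewSum_oneSum_mem_avoidersLe_iff.1 hp, rfl⟩
    · rintro ⟨q, hq, rfl⟩
      exact ⟨skewSum_oneSum_mem_avoidersLe_iff.2 hq, skewSum_oneSum_natAdd_zero q.1 q.2⟩
  rw [himage, Set.ncard_image_of_injective, Set.ncard_prod, numLe, numLe]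
  exact fun q q' h => Prod.ext (skewSum_injective2 h).1 (oneSum_injective (skewSum_injective2 h).2)

theorem numLe_zero_left (m : ℕ) : numLe pattern213 0 m = 1 := by
  refine Set.ncard_eq_one.2 ⟨1, Set.eq_singleton_iff_unique_mem.2
    ⟨⟨?_, (lis_le_size _).trans m.zero_le⟩, fun q _ => Subsingleton.elim _ _⟩⟩
  rintro ⟨f, -⟩
  exact (f 0).elim0

theorem numLe_succ_zero (τ : Perm (Fin k)) (n : ℕ) : numLe τ (n + 1) 0 = 0 := by
  refine (Set.ncard_eq_zero (Set.toFinite _)).2 (Set.eq_empty_iff_forall_notMem.2 ?_)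
  rintro p ⟨-, hp⟩
  have hone : 1 ≤ lis p := le_lis_iff.2 (contains_one_iff.2
    ⟨fun _ => 0, Subsingleton.strictMono _, Subsingleton.strictMono _⟩)
  omega

theorem ncard_eq_sum_ncard_apply_eq_zero (A : Set (Perm (Fin (n + 1)))) :
    A.ncard = ∑ x, {p ∈ A | p x = 0}.ncard := by
  classical
  rw [Set.ncard_eq_toFinset_card' A, Finset.card_eq_sum_card_fiberwise
    (f := fun p => p.symm 0) (t := Finset.univ) fun p _ => Finset.mem_univ _]
  refine Finset.sum_congr rfl fun x _ => ?_
  rw [← Set.ncard_coe_finset]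
  congr 1
  ext p
  simp [Equiv.symm_apply_eq, eq_comm (a := (0 : Fin (n + 1)))]

theorem numLe_succ_succ (n m : ℕ) : numLe pattern213 (n + 1) (m + 1) =
    ∑ ij ∈ Finset.HasAntidiagonal.antidiagonal n,
      numLe pattern213 ij.1 (m + 1) * numLe pattern213 ij.2 m := by
  have hfiber (i j n : ℕ) (hn : i + j = n) (x : Fin (n + 1)) (hx : x.1 = i) :
      {p ∈ avoidersLe pattern213 (n + 1) (m + 1) | p x = 0}.ncard =
        numLe pattern213 i (m + 1) * numLe pattern213 j m := by
    subst hn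
    obtain rfl : x = Fin.natAdd i (0 : Fin (j + 1)) := Fin.ext hx
    exact ncard_avoidersLe_of_apply_eq_zero i j m
  rw [numLe, ncard_eq_sum_ncard_apply_eq_zero, Finset.Nat.sum_antidiagonal_eq_sum_range_succ_mk,
    Finset.sum_range]
  exact Finset.sum_congr rfl fun x _ => hfiber x (n - x) n (by omega) x rfl

end Counting

section LatticeSum

/-- The binomial coefficient `m.choose j`, as a real number, for an integer `j`; it vanishes unless
`0 ≤ j ≤ m`. -/
noncomputable def binomZ : ℕ → ℤ → ℝ
  | 0, j => if j = 0 then 1 else 0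
  | m + 1, j => binomZ m (j - 1) + binomZ m j

theorem binomZ_succ (m : ℕ) (j : ℤ) : binomZ (m + 1) j = binomZ m (j - 1) + binomZ m j := rfl

theorem binomZ_eq_zero_of_neg (m : ℕ) {j : ℤ} (hj : j < 0) : binomZ m j = 0 := by
  induction m generalizing j with
  | zero => simp [binomZ, hj.ne]
  | succ m ih => rw [binomZ_succ, ih hj, ih (by omega), add_zero]

theorem binomZ_natCast (m j : ℕ) : binomZ m j = m.choose j := by
  induction m generalizing j with
  | zero => cases j <;> simp [binomZ]; omega
  | succ m ih =>
    rw [binomZ_succ]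
    cases j with
    | zero => simpa [ih, binomZ_eq_zero_of_neg] using ih 0
    | succ j =>
      rw [ih, Nat.cast_succ, add_sub_cancel_right, ih, Nat.choose_succ_succ, Nat.cast_add]

theorem binomZ_symm (m : ℕ) (j : ℤ) : binomZ m (m - j) = binomZ m j := by
  induction m generalizing j with
  | zero => simp [binomZ]
  | succ m ih =>
    rw [binomZ_succ, binomZ_succ, ← ih j, ← ih (j - 1), add_comm]
    push_cast
    ring_nf

theorem binomZ_eq_zero_of_lt {m : ℕ} {j : ℤ} (hj : m < j) : binomZ m j = 0 := by
  rw [← binomZ_symm, binomZ_eq_zero_of_neg _ (by omega)]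

theorem mul_binomZ (m : ℕ) (j : ℤ) : j * binomZ m j = (m + 1 - j) * binomZ m (j - 1) := by
  induction m generalizing j with
  | zero =>
    by_cases h0 : j = 0 <;> by_cases h1 : j = 1 <;> simp_all [binomZ, sub_eq_zero]
  | succ m ih =>
    have hj := ih j
    have hj' := ih (j - 1)
    rw [binomZ_succ, binomZ_succ]
    push_cast at hj hj' ⊢
    linear_combination hj + hj'

theorem binomZ_second_difference (n : ℕ) (s : ℤ) :
    (2 * (n + 1) * (2 * n + 1)) * (2 * binomZ (2 * n) (n + s) - binomZ (2 * n) (n + 1 + s)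
      - binomZ (2 * n) (n - 1 + s)) =
      2 * (binomZ (2 * (n + 1)) (n + 1 + s) * ((n + 1) - 2 * (s : ℝ) ^ 2)) := by
  have hdown := mul_binomZ (2 * n) (n + s)
  have hup := mul_binomZ (2 * n) (n + 1 + s)
  have hsum : binomZ (2 * (n + 1)) (n + 1 + s) = binomZ (2 * n) (n - 1 + s)
      + 2 * binomZ (2 * n) (n + s) + binomZ (2 * n) (n + 1 + s) := by
    rw [show 2 * (n + 1) = 2 * n + 1 + 1 by ring, binomZ_succ, binomZ_succ, binomZ_succ]
    ring_nf
  rw [show (n : ℤ) + s - 1 = n - 1 + s by ring] at hdown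
  rw [show (n : ℤ) + 1 + s - 1 = n + s by ring] at hup
  rw [hsum]
  push_cast at hdown hup ⊢
  linear_combination (4 * (n + s + 1 : ℝ)) * hdown - (4 * (n - s + 1 : ℝ)) * hup

variable {K : ℕ}

theorem summable_binomZ_mul (hK : K ≠ 0) (m : ℕ) (s : ℤ) (f : ℤ → ℝ) :
    Summable fun t : ℤ => binomZ m (s + t * K) * f t := by
  have hinj : Function.Injective fun t : ℤ => s + t * K := fun a b hab => by simpa [hK] using hab
  refine summable_of_hasFiniteSupport (((Set.finite_Icc (0 : ℤ) m).preimage hinj.injOn).subset ?_)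
  refine fun t ht => Set.mem_preimage.2 ⟨?_, ?_⟩ <;> by_contra! h
  · exact ht (by simp [binomZ_eq_zero_of_neg m h])
  · exact ht (by simp [binomZ_eq_zero_of_lt h])

theorem summable_binomZ (hK : K ≠ 0) (m : ℕ) (s : ℤ) :
    Summable fun t : ℤ => binomZ m (s + t * K) := by
  simpa using summable_binomZ_mul hK m s fun _ => 1

/-- The sum of the binomial coefficients in row `m` over the residue class of `s` modulo `K`. -/
noncomputable def latticeSum (K m : ℕ) (s : ℤ) : ℝ := ∑' t : ℤ, binomZ m (s + t * K)

theorem latticeSum_succ (hK : K ≠ 0) (m : ℕ) (s : ℤ) :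
    latticeSum K (m + 1) s = latticeSum K m (s - 1) + latticeSum K m s := by
  rw [latticeSum, latticeSum, latticeSum,
    ← (summable_binomZ hK m (s - 1)).tsum_add (summable_binomZ hK m s)]
  exact tsum_congr fun t => by rw [binomZ_succ, add_sub_right_comm]

theorem latticeSum_reflect (K m : ℕ) (s : ℤ) : latticeSum K m (m - s) = latticeSum K m s := by
  rw [latticeSum, latticeSum, ← (Equiv.neg ℤ).tsum_eq]
  refine tsum_congr fun t => ?_
  rw [← binomZ_symm m (s + t * K), Equiv.neg_apply]
  ring_nf

theorem latticeSum_shift (K m : ℕ) (s : ℤ) : latticeSum K m (s + K) = latticeSum K m s := by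
  rw [latticeSum, latticeSum,
    ← (Equiv.addRight (1 : ℤ)).tsum_eq fun t => binomZ m (s + t * K)]
  refine tsum_congr fun t => ?_
  rw [Equiv.coe_addRight]
  ring_nf

theorem latticeSum_eq_binomZ {m : ℕ} {s : ℤ} (hs : s < K) (hm : m < s + K) :
    latticeSum K m s = binomZ m s := by
  rw [latticeSum, tsum_eq_single 0, zero_mul, add_zero]
  intro t ht
  rcases lt_or_gt_of_ne ht with ht | ht
  · exact binomZ_eq_zero_of_neg m (by nlinarith)
  · exact binomZ_eq_zero_of_lt (by nlinarith)

end LatticeSum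

section Strip

open PowerSeries

variable {K k h : ℕ}

/-- The number of lattice paths with steps `±1` from height `h` to height `0` that have `n` up-steps
and stay between the heights `0` and `K - 2`, as given by the reflection principle. -/
noncomputable def stripCount (K h n : ℕ) : ℝ :=
  latticeSum K (2 * n + h) (n + h) - latticeSum K (2 * n + h) (n + h + 1)

theorem stripCount_succ (hK : K ≠ 0) (h n : ℕ) :
    stripCount K (h + 1) (n + 1) = stripCount K h (n + 1) + stripCount K (h + 2) n := by
  simp only [stripCount]
  rw [show 2 * (n + 1) + (h + 1) = 2 * n + h + 2 + 1 by ring,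
    latticeSum_succ hK (2 * n + h + 2), latticeSum_succ hK (2 * n + h + 2),
    show 2 * (n + 1) + h = 2 * n + h + 2 by ring,
    show 2 * n + (h + 2) = 2 * n + h + 2 by ring]
  push_cast
  ring_nf

theorem stripCount_zero_succ (hK : K ≠ 0) (n : ℕ) :
    stripCount K 0 (n + 1) = stripCount K 1 n := by
  have hreflect := latticeSum_reflect K (2 * n + 1) n
  simp only [stripCount]
  rw [show 2 * (n + 1) + 0 = 2 * n + 1 + 1 by ring, latticeSum_succ hK (2 * n + 1),
    latticeSum_succ hK (2 * n + 1)]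
  push_cast at hreflect ⊢
  ring_nf at hreflect ⊢
  rw [hreflect]

theorem stripCount_top (k n : ℕ) : stripCount (k + 2) (k + 1) n = 0 := by
  have hreflect := latticeSum_reflect (k + 2) (2 * n + (k + 1)) (n + (k + 1) + 1)
  have hshift := latticeSum_shift (k + 2) (2 * n + (k + 1)) (n - 1)
  rw [stripCount]
  push_cast at hreflect hshift ⊢
  ring_nf at hreflect hshift ⊢
  rw [← hreflect, ← hshift, sub_self]

theorem stripCount_zero_right (hh : h ≤ k) : stripCount (k + 2) h 0 = 1 := by
  have hself : binomZ h h = 1 := by simp [binomZ_natCast]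
  have hnext : binomZ h (h + 1) = 0 := binomZ_eq_zero_of_lt (by omega)
  simp only [stripCount, mul_zero, zero_add, Nat.cast_zero]
  rw [latticeSum_eq_binomZ (by omega) (by omega), latticeSum_eq_binomZ (by omega) (by omega),
    hself, hnext, sub_zero]

/-- The generating function, by size, of the `(213)`-avoiders that have no increasing subsequence
of length more than `k`. -/
noncomputable def genLe (k : ℕ) : ℝ⟦X⟧ := PowerSeries.mk fun n => (numLe pattern213 n k : ℝ)

theorem genLe_zero : genLe 0 = 1 := by
  ext n
  cases n with
  | zero => simp [genLe, numLe_zero_left]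
  | succ n => simp [genLe, numLe_succ_zero, PowerSeries.coeff_one]

theorem genLe_succ (k : ℕ) : genLe (k + 1) = 1 + X * (genLe (k + 1) * genLe k) := by
  ext n
  cases n with
  | zero => simp [genLe, numLe_zero_left]
  | succ n =>
    rw [map_add, PowerSeries.coeff_succ_X_mul, PowerSeries.coeff_mul]
    simp [genLe, numLe_succ_succ, PowerSeries.coeff_one]

/-- The generating function of `stripCount`, by the number of up-steps. -/
noncomputable def genStrip (K h : ℕ) : ℝ⟦X⟧ := PowerSeries.mk (stripCount K h)

theorem genStrip_succ (hh : h + 1 ≤ k) :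
    genStrip (k + 2) (h + 1) = genStrip (k + 2) h + X * genStrip (k + 2) (h + 2) := by
  ext n
  cases n with
  | zero => simp [genStrip, stripCount_zero_right hh, stripCount_zero_right (Nat.le_of_succ_le hh)]
  | succ n =>
    rw [map_add, PowerSeries.coeff_succ_X_mul]
    simp [genStrip, stripCount_succ]

theorem genStrip_zero (k : ℕ) : genStrip (k + 2) 0 = 1 + X * genStrip (k + 2) 1 := by
  ext n
  cases n with
  | zero => simp [genStrip, stripCount_zero_right]
  | succ n =>
    rw [map_add, PowerSeries.coeff_succ_X_mul]
    simp [genStrip, stripCount_zero_succ, PowerSeries.coeff_one]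

theorem genStrip_top (k : ℕ) : genStrip (k + 2) (k + 1) = 0 := by
  ext n
  simp [genStrip, stripCount_top]

-- A path from height `h + 1` splits at its first arrival at height `h`, above which the strip has
-- room for `j` more levels.
theorem genStrip_succ_eq_genLe_mul {j : ℕ} (hk : h + 1 + j = k) :
    genStrip (k + 2) (h + 1) = genLe j * genStrip (k + 2) h := by
  induction j generalizing h with
  | zero =>
    have hstep := genStrip_succ (k := k) (h := h) (by omega)
    rw [show h + 2 = k + 1 by omega, genStrip_top] at hstep
    rw [genLe_zero, hstep]
    ring
  | succ j ih =>
    have hstep := genStrip_succ (k := k) (h := h) (by omega)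
    rw [ih (h := h + 1) (by omega)] at hstep
    linear_combination genLe (j + 1) * hstep - genStrip (k + 2) (h + 1) * genLe_succ j

theorem genStrip_eq_genLe (k : ℕ) : genStrip (k + 2) 0 = genLe k := by
  cases k with
  | zero => rw [genStrip_zero, genStrip_top, genLe_zero, mul_zero, add_zero]
  | succ k =>
    have hstep := genStrip_zero (k + 1)
    rw [genStrip_succ_eq_genLe_mul (j := k) (by omega)] at hstep
    linear_combination genLe (k + 1) * hstep - genStrip (k + 1 + 2) 0 * genLe_succ k

theorem numLe_eq_stripCount (n k : ℕ) : (numLe pattern213 n k : ℝ) = stripCount (k + 2) 0 n := by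
  simpa [genStrip, genLe] using (congrArg (PowerSeries.coeff n) (genStrip_eq_genLe k)).symm

end Strip

section ExactDistribution

theorem two_mul_numLe (n k : ℕ) : 2 * (numLe pattern213 n k : ℝ) =
    ∑' t : ℤ, (2 * binomZ (2 * n) (n + t * (k + 2 : ℕ))
      - binomZ (2 * n) (n + 1 + t * (k + 2 : ℕ)) - binomZ (2 * n) (n - 1 + t * (k + 2 : ℕ))) := by
  have hs := summable_binomZ (K := k + 2) (by omega) (2 * n)
  have hreflect : latticeSum (k + 2) (2 * n) (n + 1) = latticeSum (k + 2) (2 * n) (n - 1) := by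
    rw [← latticeSum_reflect]
    push_cast
    ring_nf
  rw [(((hs n).mul_left 2).sub (hs (n + 1))).tsum_sub (hs (n - 1)),
    ((hs n).mul_left 2).tsum_sub (hs (n + 1)), tsum_mul_left, numLe_eq_stripCount, stripCount]
  change _ = 2 * latticeSum (k + 2) (2 * n) n - latticeSum (k + 2) (2 * n) (n + 1)
    - latticeSum (k + 2) (2 * n) (n - 1)
  rw [← hreflect]
  push_cast
  ring_nf

theorem mul_numLe_eq_tsum (n k : ℕ) :
    (2 * (n + 1) * (2 * n + 1)) * (numLe pattern213 n k : ℝ) =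
      ∑' t : ℤ, binomZ (2 * (n + 1)) (n + 1 + t * (k + 2 : ℕ)) *
        ((n + 1) - 2 * ((t : ℝ) * (k + 2 : ℕ)) ^ 2) := by
  refine mul_left_cancel₀ (two_ne_zero (α := ℝ)) ?_
  rw [mul_left_comm, two_mul_numLe, ← tsum_mul_left, ← tsum_mul_left]
  refine tsum_congr fun t => ?_
  rw [binomZ_second_difference]
  push_cast
  rfl

theorem tsum_int_of_even {f : ℤ → ℝ} (hf : f.Even) (hs : Summable f) :
    ∑' t : ℤ, f t = f 0 + 2 * ∑' t : ℕ, f ((t + 1 : ℕ) : ℤ) := by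
  rw [tsum_int_eq_zero_add_two_mul_tsum_pnat hf hs,
    ← tsum_pnat_eq_tsum_succ (f := fun t : ℕ => f (t : ℤ)), nsmul_eq_mul]
  rfl

/-- The binomial coefficient at distance `j` from the middle of row `2 * N`, divided by the central
one. -/
noncomputable def binomRatio (N j : ℕ) : ℝ := ((2 * N).choose (N + j) : ℝ) / N.centralBinom

theorem centralBinom_cast_ne_zero (N : ℕ) : (N.centralBinom : ℝ) ≠ 0 :=
  Nat.cast_ne_zero.2 N.centralBinom_ne_zero

theorem binomRatio_zero (N : ℕ) : binomRatio N 0 = 1 :=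
  div_self (centralBinom_cast_ne_zero N)

theorem binomRatio_of_lt {N j : ℕ} (h : N < j) : binomRatio N j = 0 := by
  rw [binomRatio, Nat.choose_eq_zero_of_lt (by omega), Nat.cast_zero, zero_div]

/-- The probability that a random `(213)`-avoider of size `n` has an increasing subsequence of
length more than `k`, in closed form. -/
noncomputable def lisTail (n k : ℕ) : ℝ :=
  ∑' t : ℕ, 2 * (2 * (((t + 1) * (k + 2) : ℕ) : ℝ) ^ 2 / (n + 1) - 1) *
    binomRatio (n + 1) ((t + 1) * (k + 2))

theorem lisTail_eq_zero_of_le {n k : ℕ} (h : n ≤ k) : lisTail n k = 0 := by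
  refine (tsum_congr fun t => ?_).trans tsum_zero
  rw [binomRatio_of_lt (by nlinarith), mul_zero]

theorem mul_catalan (n : ℕ) : (2 * (n + 1) * (2 * n + 1)) * (catalan n : ℝ) =
    (n + 1) * (n + 1).centralBinom := by
  have hcatalan : ((n : ℝ) + 1) * catalan n = n.centralBinom := by
    exact_mod_cast succ_mul_catalan_eq_centralBinom n
  have hsucc : ((n : ℝ) + 1) * (n + 1).centralBinom = 2 * (2 * n + 1) * n.centralBinom := by
    exact_mod_cast n.succ_mul_centralBinom_succ
  linear_combination 2 * (2 * (n : ℝ) + 1) * hcatalan - hsucc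

theorem numLe_eq_catalan_mul (n k : ℕ) :
    (numLe pattern213 n k : ℝ) = catalan n * (1 - lisTail n k) := by
  have hpos : (2 * (n + 1) * (2 * n + 1) : ℝ) ≠ 0 := by positivity
  have hc := centralBinom_cast_ne_zero (n + 1)
  refine mul_left_cancel₀ hpos ?_
  have hs := summable_binomZ_mul (K := k + 2) (by omega) (2 * (n + 1)) (n + 1)
    fun t => (n + 1) - 2 * ((t : ℝ) * (k + 2 : ℕ)) ^ 2
  rw [mul_numLe_eq_tsum, tsum_int_of_even ?_ hs, ← mul_assoc, mul_catalan, lisTail, mul_one_sub,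
    ← tsum_mul_left, ← tsum_mul_left, sub_eq_add_neg (_ * _) (tsum _), ← tsum_neg]
  · congr 1
    · have hcentral := binomZ_natCast (2 * (n + 1)) (n + 1)
      rw [Nat.cast_succ] at hcentral
      rw [Int.cast_zero, zero_mul, zero_mul, add_zero, hcentral, Nat.centralBinom]
      ring
    · refine tsum_congr fun t => ?_
      have hbinom := binomZ_natCast (2 * (n + 1)) (n + 1 + (t + 1) * (k + 2))
      rw [binomRatio]
      push_cast at hbinom ⊢
      rw [hbinom]
      field_simp
      ring
  · intro t
    dsimp only
    rw [← binomZ_symm]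
    push_cast
    congr 2 <;> ring

end ExactDistribution

section BinomialApproximation

theorem binomRatio_succ {N j : ℕ} (h : j ≤ N) :
    binomRatio N (j + 1) = binomRatio N j * (1 - (2 * j + 1) / (N + j + 1)) := by
  have hchoose : ((2 * N).choose (N + j + 1) : ℝ) * (N + j + 1) =
      (2 * N).choose (N + j) * (N - j) := by
    have hsucc := Nat.choose_succ_right_eq (2 * N) (N + j)
    rw [show 2 * N - (N + j) = N - j by omega] at hsucc
    rw [← Nat.cast_sub h]
    exact_mod_cast hsucc
  have hden : (N + j + 1 : ℝ) ≠ 0 := by positivity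
  rw [binomRatio, binomRatio, ← add_assoc, eq_div_of_mul_eq hden hchoose]
  field_simp
  ring

theorem exp_neg_le_quadratic {y : ℝ} (hy : 0 ≤ y) : Real.exp (-y) ≤ 1 - y + y ^ 2 / 2 := by
  have hpos : (0 : ℝ) < 1 + y + y ^ 2 / 2 := by positivity
  rw [Real.exp_neg]
  refine (inv_anti₀ hpos (Real.quadratic_le_exp_of_nonneg hy)).trans ?_
  rw [inv_le_iff_one_le_mul₀ hpos]
  nlinarith [sq_nonneg (y ^ 2)]

theorem abs_one_sub_div_sub_exp_le {N j : ℝ} (hN : 0 < N) (hj : 0 ≤ j) :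
    |1 - (2 * j + 1) / (N + j + 1) - Real.exp (-((2 * j + 1) / N))| ≤ 4 * (j + 1) ^ 2 / N ^ 2 := by
  set y := (2 * j + 1) / N with hy
  have hy0 : 0 ≤ y := by positivity
  have hsq : y ^ 2 / 2 ≤ 2 * (j + 1) ^ 2 / N ^ 2 := by
    rw [hy, div_pow, div_div, mul_comm (N ^ 2), ← div_div]
    gcongr
    nlinarith
  have hsub : y - (2 * j + 1) / (N + j + 1) = (2 * j + 1) * (j + 1) / (N * (N + j + 1)) := by
    rw [hy]
    field_simp
    ring
  have hsub_nonneg : 0 ≤ y - (2 * j + 1) / (N + j + 1) := by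
    rw [hsub]
    positivity
  have hsub_le : y - (2 * j + 1) / (N + j + 1) ≤ 2 * (j + 1) ^ 2 / N ^ 2 := by
    rw [hsub, sq N]
    refine div_le_div₀ (by positivity) (by nlinarith) (by positivity) ?_
    gcongr
    linarith
  have hdouble : 4 * (j + 1) ^ 2 / N ^ 2 = 2 * (2 * (j + 1) ^ 2 / N ^ 2) := by ring
  rw [abs_le]
  constructor <;> linarith [exp_neg_le_quadratic hy0, Real.one_sub_le_exp_neg y]

theorem exp_neg_sq_succ_div (j M : ℝ) : Real.exp (-((j + 1) ^ 2 / M)) =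
    Real.exp (-(j ^ 2 / M)) * Real.exp (-((2 * j + 1) / M)) := by
  rw [← Real.exp_add]
  ring_nf

theorem one_third_le_exp_neg_one : (1 / 3 : ℝ) ≤ Real.exp (-1) := by
  rw [Real.exp_neg, one_div]
  exact inv_anti₀ (Real.exp_pos 1) (Real.exp_one_lt_d9.le.trans (by norm_num))

theorem exp_neg_sq_div_le (j N : ℕ) :
    Real.exp (-((j : ℝ) ^ 2 / N)) ≤ Real.exp (-((j : ℝ) ^ 2 / (2 * N))) := by
  have hsq : (0 : ℝ) ≤ (j : ℝ) ^ 2 / N := by positivity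
  rw [Real.exp_le_exp, mul_comm, ← div_div]
  linarith

theorem abs_binomRatio_succ_sub_exp_le {N j : ℕ} (hj : j + 1 ≤ N) :
    |binomRatio N (j + 1) - Real.exp (-(((j : ℝ) + 1) ^ 2 / N))| ≤
      |binomRatio N j - Real.exp (-((j : ℝ) ^ 2 / N))| * Real.exp (-((2 * j + 1) / (2 * N))) +
        Real.exp (-((j : ℝ) ^ 2 / N)) * (4 * (j + 1) ^ 2 / N ^ 2) := by
  have hN : (0 : ℝ) < N := by exact_mod_cast (Nat.succ_pos j).trans_le hj
  have hjN : (j + 1 : ℝ) ≤ N := by exact_mod_cast hj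
  set u : ℝ := 1 - (2 * j + 1) / (N + j + 1) with hu
  set a := Real.exp (-((j : ℝ) ^ 2 / N))
  set b := Real.exp (-((2 * j + 1) / (N : ℝ)))
  have hu0 : 0 ≤ u := by
    rw [hu, sub_nonneg, div_le_one (by positivity)]
    linarith
  have hu1 : u ≤ Real.exp (-((2 * j + 1) / (2 * N))) := by
    refine le_trans ?_ (Real.one_sub_le_exp_neg _)
    rw [hu]
    gcongr
    linarith
  have hub : |u - b| ≤ 4 * (j + 1) ^ 2 / N ^ 2 := abs_one_sub_div_sub_exp_le hN j.cast_nonneg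
  calc |binomRatio N (j + 1) - Real.exp (-(((j : ℝ) + 1) ^ 2 / N))|
      = |(binomRatio N j - a) * u + a * (u - b)| := by
        rw [binomRatio_succ (by omega), exp_neg_sq_succ_div]
        congr 1
        ring
    _ ≤ |binomRatio N j - a| * u + a * |u - b| := by
        refine (abs_add_le _ _).trans_eq ?_
        rw [abs_mul, abs_mul, abs_of_nonneg hu0, Real.abs_exp]
    _ ≤ _ := by gcongr

theorem abs_binomRatio_sub_exp_le_of_le {N j : ℕ} (hj : j ≤ N) :
    |binomRatio N j - Real.exp (-((j : ℝ) ^ 2 / N))| ≤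
      12 * (j : ℝ) ^ 3 / N ^ 2 * Real.exp (-((j : ℝ) ^ 2 / (2 * N))) := by
  induction j with
  | zero => simp [binomRatio_zero]
  | succ j ih =>
    have hN : (0 : ℝ) < N := by exact_mod_cast (Nat.succ_pos j).trans_le hj
    have hjN : (j + 1 : ℝ) ≤ N := by exact_mod_cast hj
    set a := Real.exp (-((j : ℝ) ^ 2 / (2 * N))) with ha
    set v := Real.exp (-((2 * j + 1) / (2 * N : ℝ))) with hv
    have hv3 : 1 ≤ 3 * v := by
      have hle : -1 ≤ -((2 * j + 1) / (2 * N : ℝ)) := by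
        rw [neg_le_neg_iff, div_le_one (by positivity)]
        linarith
      linarith [one_third_le_exp_neg_one, Real.exp_le_exp.2 hle]
    push_cast
    calc _ ≤ 12 * (j : ℝ) ^ 3 / N ^ 2 * a * v + a * (4 * (j + 1) ^ 2 / N ^ 2 * 1) := by
          refine (abs_binomRatio_succ_sub_exp_le hj).trans ?_
          rw [mul_one]
          gcongr
          · exact ih (by omega)
          · exact exp_neg_sq_div_le j N
      _ ≤ 12 * (j : ℝ) ^ 3 / N ^ 2 * a * v + a * (4 * (j + 1) ^ 2 / N ^ 2 * (3 * v)) := by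
          gcongr
      _ = 12 * ((j : ℝ) ^ 3 + (j + 1) ^ 2) / N ^ 2 * (a * v) := by ring
      _ ≤ 12 * ((j : ℝ) + 1) ^ 3 / N ^ 2 * (a * v) := by
          gcongr
          nlinarith [j.cast_nonneg (α := ℝ)]
      _ = _ := by rw [ha, hv, ← exp_neg_sq_succ_div]

theorem abs_binomRatio_sub_exp_le {N : ℕ} (hN : 0 < N) (j : ℕ) :
    |binomRatio N j - Real.exp (-((j : ℝ) ^ 2 / N))| ≤
      12 * (j : ℝ) ^ 3 / N ^ 2 * Real.exp (-((j : ℝ) ^ 2 / (2 * N))) := by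
  rcases le_or_gt j N with h | h
  · exact abs_binomRatio_sub_exp_le_of_le h
  have hN' : (1 : ℝ) ≤ N := by exact_mod_cast hN
  have hcoef : (1 : ℝ) ≤ 12 * (j : ℝ) ^ 3 / N ^ 2 := by
    rw [one_le_div (by positivity)]
    calc (N : ℝ) ^ 2 ≤ (N : ℝ) ^ 3 := by gcongr; norm_num
      _ ≤ (j : ℝ) ^ 3 := by gcongr
      _ ≤ 12 * (j : ℝ) ^ 3 := le_mul_of_one_le_left (by positivity) (by norm_num)
  rw [binomRatio_of_lt h, zero_sub, abs_neg, Real.abs_exp]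
  exact (exp_neg_sq_div_le j N).trans (le_mul_of_one_le_left (Real.exp_pos _).le hcoef)

end BinomialApproximation

section GaussianSums

/-- A rapidly decreasing weight against which series with Gaussian terms are bounded. -/
noncomputable def gaussWeight (y : ℝ) : ℝ := (1 + y ^ 2) ^ 3 * Real.exp (-(y ^ 2 / 2))

theorem gaussWeight_nonneg (y : ℝ) : 0 ≤ gaussWeight y := by
  unfold gaussWeight
  positivity

theorem mul_exp_neg_sq_le_gaussWeight {a y : ℝ} (ha : a ≤ 1 + y ^ 2) :
    a * Real.exp (-y ^ 2) ≤ gaussWeight y := by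
  have hcube : a ≤ (1 + y ^ 2) ^ 3 :=
    ha.trans (le_self_pow₀ (by nlinarith [sq_nonneg y]) (by norm_num))
  rw [gaussWeight]
  gcongr
  linarith [sq_nonneg y]

theorem exists_gaussWeight_le_rpow {s : ℝ} (hs : 0 ≤ s) :
    ∃ C : ℝ, 0 ≤ C ∧ ∀ y : ℝ, 0 < y → gaussWeight y ≤ C * y ^ (-s) := by
  set m := ⌈s⌉₊
  refine ⟨2 ^ (m + 3) * (m + 3).factorial * Real.exp (1 / 2), by positivity, fun y hy => ?_⟩
  have hpow : y ^ s ≤ (1 + y ^ 2) ^ m := by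
    rw [← Real.rpow_natCast]
    calc y ^ s ≤ (1 + y ^ 2) ^ s := by gcongr; nlinarith
      _ ≤ (1 + y ^ 2) ^ (m : ℝ) :=
        Real.rpow_le_rpow_of_exponent_le (by nlinarith) (Nat.le_ceil s)
  have hexp : (1 + y ^ 2) ^ (m + 3) ≤
      2 ^ (m + 3) * (m + 3).factorial * Real.exp ((1 + y ^ 2) / 2) := by
    have h := Real.pow_div_factorial_le_exp ((1 + y ^ 2) / 2) (by positivity) (m + 3)
    rw [div_pow, div_div, div_le_iff₀ (by positivity)] at h
    linarith
  rw [Real.rpow_neg hy.le, ← div_eq_mul_inv, le_div_iff₀ (Real.rpow_pos_of_pos hy s)]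
  calc gaussWeight y * y ^ s ≤ gaussWeight y * (1 + y ^ 2) ^ m := by
        gcongr
        exact gaussWeight_nonneg y
    _ = (1 + y ^ 2) ^ (m + 3) * Real.exp (-(y ^ 2 / 2)) := by rw [gaussWeight]; ring
    _ ≤ 2 ^ (m + 3) * (m + 3).factorial * Real.exp ((1 + y ^ 2) / 2) *
        Real.exp (-(y ^ 2 / 2)) := by gcongr
    _ = _ := by rw [mul_assoc, ← Real.exp_add]; ring_nf

/-- A sequence of functions on `(0, ∞)` is Gauss-dominated if its `t`-th term is at most a constant
times `gaussWeight` at `(t + 1) * x`; this is the form of the terms of theta-like series. -/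
def GaussDominated (f : ℕ → ℝ → ℝ) : Prop :=
  ∃ c, ∀ t x, 0 < x → |f t x| ≤ c * gaussWeight ((t + 1) * x)

theorem gaussDominated_gaussWeight : GaussDominated fun t x => gaussWeight ((t + 1) * x) :=
  ⟨1, fun t x _ => by rw [abs_of_nonneg (gaussWeight_nonneg _), one_mul]⟩

theorem summable_succ_rpow {s : ℝ} (hs : 1 < s) : Summable fun t : ℕ => ((t : ℝ) + 1) ^ (-s) := by
  simpa using (summable_nat_add_iff 1).2 (Real.summable_nat_rpow.2 (neg_lt_neg hs))

namespace GaussDominated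

variable {f F : ℕ → ℝ → ℝ}

theorem exists_abs_le_rpow (hf : GaussDominated f) {s : ℝ} (hs : 0 ≤ s) :
    ∃ C, 0 ≤ C ∧ ∀ (t : ℕ) (x : ℝ), 0 < x → |f t x| ≤ C * x ^ (-s) * ((t : ℝ) + 1) ^ (-s) := by
  obtain ⟨c, hc⟩ := hf
  obtain ⟨C, hC, hle⟩ := exists_gaussWeight_le_rpow hs
  refine ⟨|c| * C, by positivity, fun t x hx => ?_⟩
  calc |f t x| ≤ |c| * gaussWeight ((t + 1) * x) :=
        (hc t x hx).trans (mul_le_mul_of_nonneg_right (le_abs_self c) (gaussWeight_nonneg _))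
    _ ≤ |c| * (C * ((t + 1) * x) ^ (-s)) := by gcongr; exact hle _ (by positivity)
    _ = _ := by rw [Real.mul_rpow (by positivity) hx.le]; ring

theorem summable (hf : GaussDominated f) {x : ℝ} (hx : 0 < x) : Summable fun t => f t x := by
  obtain ⟨C, -, hle⟩ := hf.exists_abs_le_rpow (s := 2) zero_le_two
  exact .of_norm_bounded ((summable_succ_rpow one_lt_two).mul_left (C * x ^ (-2 : ℝ)))
    fun t => hle t x hx

theorem exists_abs_tsum_le_rpow (hf : GaussDominated f) {s : ℝ} (hs : 1 < s) :
    ∃ C, ∀ x, 0 < x → |∑' t, f t x| ≤ C * x ^ (-s) := by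
  obtain ⟨C, -, hle⟩ := hf.exists_abs_le_rpow (zero_le_one.trans hs.le)
  refine ⟨C * ∑' t : ℕ, ((t : ℝ) + 1) ^ (-s), fun x hx => ?_⟩
  rw [← Real.norm_eq_abs]
  refine (tsum_of_norm_bounded ((summable_succ_rpow hs).mul_left (C * x ^ (-s))).hasSum
    fun t => hle t x hx).trans_eq ?_
  rw [tsum_mul_left]
  ring

theorem isBigO_tsum (hf : GaussDominated f) {s : ℝ} (hs : 1 < s) :
    (fun x => ∑' t, f t x) =O[atTop] fun x => x ^ (-s) := by
  obtain ⟨C, hle⟩ := hf.exists_abs_tsum_le_rpow hs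
  refine IsBigO.of_bound C ?_
  filter_upwards [eventually_gt_atTop 0] with x hx
  rw [Real.norm_of_nonneg (Real.rpow_nonneg hx.le _)]
  exact hle x hx

theorem exists_summable_bound (hf : GaussDominated f) {a : ℝ} (ha : 0 < a) :
    ∃ u : ℕ → ℝ, Summable u ∧ ∀ t, ∀ x ∈ Set.Ioi a, ‖f t x‖ ≤ u t := by
  obtain ⟨C, hC, hle⟩ := hf.exists_abs_le_rpow (s := 2) zero_le_two
  refine ⟨_, (summable_succ_rpow one_lt_two).mul_left (C * a ^ (-2 : ℝ)), fun t x hx => ?_⟩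
  refine (hle t x (ha.trans hx)).trans ?_
  gcongr ?_ * _
  gcongr C * ?_
  exact Real.rpow_le_rpow_of_nonpos ha hx.le (by norm_num)

theorem hasDerivAt_tsum (hf : GaussDominated f) (hF : GaussDominated F)
    (hderiv : ∀ t x, HasDerivAt (F t) (f t x) x) {x : ℝ} (hx : 0 < x) :
    HasDerivAt (fun x => ∑' t, F t x) (∑' t, f t x) x := by
  obtain ⟨u, hu, hle⟩ := hf.exists_summable_bound (half_pos hx)
  exact hasDerivAt_tsum_of_isPreconnected hu isOpen_Ioi (convex_Ioi _).isPreconnected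
    (fun t y _ => hderiv t y) hle (half_lt_self hx) (hF.summable hx) (half_lt_self hx)

theorem continuousAt_tsum (hf : GaussDominated f) (hcont : ∀ t, Continuous (f t)) {x : ℝ}
    (hx : 0 < x) : ContinuousAt (fun x => ∑' t, f t x) x := by
  obtain ⟨u, hu, hle⟩ := hf.exists_summable_bound (half_pos hx)
  exact (continuousOn_tsum (fun t => (hcont t).continuousOn) hu hle).continuousAt
    (Ioi_mem_nhds (half_lt_self hx))

end GaussDominated

end GaussianSums

section LimitTail

/-- The limit of the terms of the series `lisTail`, as a function of `(t + 1) * (k + 2) / √n`. -/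
noncomputable def gaussTerm (y : ℝ) : ℝ := 2 * (2 * y ^ 2 - 1) * Real.exp (-y ^ 2)

/-- The limit, as `n → ∞`, of the probability that `LIS / √n` exceeds `x`. -/
noncomputable def limitTail (x : ℝ) : ℝ := ∑' t : ℕ, gaussTerm ((t + 1) * x)

/-- The step of the Riemann sums that `lisTail n` gives rise to. -/
noncomputable def mesh (n : ℕ) : ℝ := (√(n + 1))⁻¹

theorem mesh_pos (n : ℕ) : 0 < mesh n := inv_pos.2 (Real.sqrt_pos.2 n.cast_add_one_pos)

theorem mesh_sq (n : ℕ) : mesh n ^ 2 = ((n : ℝ) + 1)⁻¹ := by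
  rw [mesh, inv_pow, Real.sq_sqrt (by positivity)]

theorem abs_two_mul_two_mul_sq_sub_one_le (y : ℝ) :
    |2 * (2 * y ^ 2 - 1)| ≤ 4 * (1 + y ^ 2) := by
  rw [abs_le]
  constructor <;> nlinarith [sq_nonneg y]

theorem abs_gaussTerm_le (y : ℝ) : |gaussTerm y| ≤ 4 * gaussWeight y := by
  rw [gaussTerm, abs_mul, Real.abs_exp]
  calc _ ≤ 4 * (1 + y ^ 2) * Real.exp (-y ^ 2) := by
        gcongr
        exact abs_two_mul_two_mul_sq_sub_one_le y
    _ ≤ _ := by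
        rw [mul_assoc]
        gcongr
        exact mul_exp_neg_sq_le_gaussWeight le_rfl

theorem gaussDominated_gaussTerm : GaussDominated fun t x => gaussTerm ((t + 1) * x) :=
  ⟨4, fun _ _ _ => abs_gaussTerm_le _⟩

theorem continuousAt_limitTail {x : ℝ} (hx : 0 < x) : ContinuousAt limitTail x := by
  refine gaussDominated_gaussTerm.continuousAt_tsum (fun t => ?_) hx
  unfold gaussTerm
  fun_prop

theorem abs_sub_gaussTerm_le (n j : ℕ) :
    |2 * (2 * (j : ℝ) ^ 2 / (n + 1) - 1) * binomRatio (n + 1) j - gaussTerm (j * mesh n)| ≤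
      48 * mesh n * gaussWeight (j * mesh n) := by
  set y := j * mesh n with hy
  have hh := mesh_pos n
  have _ : 0 ≤ y := by positivity
  have hyy : (j : ℝ) ^ 2 / ((n + 1 : ℕ) : ℝ) = y ^ 2 := by
    rw [hy, mul_pow, mesh_sq, div_eq_mul_inv]
    push_cast
    rfl
  have hcube : 12 * (j : ℝ) ^ 3 / ((n + 1 : ℕ) : ℝ) ^ 2 = 12 * y ^ 3 * mesh n := by
    rw [hy, div_eq_mul_inv, ← inv_pow, Nat.cast_succ, ← mesh_sq]
    ring
  have happrox := abs_binomRatio_sub_exp_le n.succ_pos j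
  rw [mul_comm 2 (_ : ℝ), ← div_div, Nat.succ_eq_add_one, hyy, hcube] at happrox
  have hpoly : (1 + y ^ 2) * y ^ 3 ≤ (1 + y ^ 2) ^ 3 := by
    have : y ^ 3 ≤ (1 + y ^ 2) ^ 2 := by
      nlinarith [sq_nonneg (y - 1), mul_nonneg (sq_nonneg y) (sq_nonneg (y - 1)), sq_nonneg y]
    nlinarith [sq_nonneg y]
  rw [mul_div_assoc 2 (_ ^ 2), ← Nat.cast_succ, Nat.succ_eq_add_one, hyy, gaussTerm, ← mul_sub,
    abs_mul]
  calc _ ≤ 4 * (1 + y ^ 2) * (12 * y ^ 3 * mesh n * Real.exp (-(y ^ 2 / 2))) := by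
        gcongr
        exact abs_two_mul_two_mul_sq_sub_one_le y
    _ = 48 * mesh n * ((1 + y ^ 2) * y ^ 3 * Real.exp (-(y ^ 2 / 2))) := by ring
    _ ≤ _ := by
        unfold gaussWeight
        gcongr

theorem summable_lisTail (n k : ℕ) :
    Summable fun t : ℕ => 2 * (2 * (((t + 1) * (k + 2) : ℕ) : ℝ) ^ 2 / (n + 1) - 1) *
      binomRatio (n + 1) ((t + 1) * (k + 2)) := by
  refine summable_of_hasFiniteSupport ((Set.finite_Iic n).subset fun t ht => ?_)
  contrapose! ht
  rw [Set.mem_Iic, not_le] at ht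
  rw [Function.notMem_support, binomRatio_of_lt (by nlinarith), mul_zero]

theorem exists_abs_lisTail_sub_limitTail_le {s : ℝ} (hs : 1 < s) :
    ∃ C, ∀ n k : ℕ, |lisTail n k - limitTail ((k + 2) * mesh n)| ≤
      C * mesh n * ((k + 2) * mesh n) ^ (-s) := by
  obtain ⟨C, hle⟩ := gaussDominated_gaussWeight.exists_abs_tsum_le_rpow hs
  refine ⟨48 * C, fun n k => ?_⟩
  have hh := mesh_pos n
  have hx : 0 < (k + 2) * mesh n := by positivity
  have hterm (t : ℕ) := abs_sub_gaussTerm_le n ((t + 1) * (k + 2))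
  have hassoc (t : ℕ) : (((t + 1) * (k + 2) : ℕ) : ℝ) * mesh n = (t + 1) * ((k + 2) * mesh n) := by
    push_cast
    ring
  simp only [hassoc] at hterm
  rw [lisTail, limitTail, ← Real.norm_eq_abs,
    ← (summable_lisTail n k).tsum_sub (gaussDominated_gaussTerm.summable hx)]
  calc _ ≤ 48 * mesh n * ∑' t : ℕ, gaussWeight ((t + 1) * ((k + 2) * mesh n)) :=
        tsum_of_norm_bounded ((gaussDominated_gaussWeight.summable hx).hasSum.mul_left _) hterm
    _ ≤ 48 * mesh n * (C * ((k + 2) * mesh n) ^ (-s)) := by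
        gcongr
        exact (le_abs_self _).trans (hle _ hx)
    _ = _ := by ring

end LimitTail

section Primitives

/-- The theta-like sum `∑ exp (-(t x) ^ 2)` over the positive integers. -/
noncomputable def gaussSum (x : ℝ) : ℝ := ∑' t : ℕ, Real.exp (-((t + 1) * x) ^ 2)

/-- The primitive of `limitTail` that vanishes at infinity. -/
noncomputable def tailPrim (x : ℝ) : ℝ := ∑' t : ℕ, -(2 * x * Real.exp (-((t + 1) * x) ^ 2))

/-- The primitive of `2 * tailPrim` that vanishes at infinity. -/
noncomputable def tailPrim₂ (x : ℝ) : ℝ :=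
  ∑' t : ℕ, 2 / ((t : ℝ) + 1) ^ 2 * Real.exp (-((t + 1) * x) ^ 2)

/-- The primitive of `2 * x * limitTail x` that vanishes at infinity, obtained by integrating by
parts. -/
noncomputable def momentPrim (x : ℝ) : ℝ := 2 * x * tailPrim x - tailPrim₂ x

theorem gaussDominated_exp : GaussDominated fun t x => Real.exp (-((t + 1) * x) ^ 2) := by
  refine ⟨1, fun t x _ => ?_⟩
  rw [Real.abs_exp, one_mul, ← one_mul (Real.exp _)]
  exact mul_exp_neg_sq_le_gaussWeight (le_add_of_nonneg_right (sq_nonneg _))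

theorem gaussDominated_tailPrim :
    GaussDominated fun t x => -(2 * x * Real.exp (-((t + 1) * x) ^ 2)) := by
  refine ⟨2, fun t x hx => ?_⟩
  rw [abs_neg, abs_mul, abs_of_pos (by positivity), Real.abs_exp, mul_assoc]
  gcongr
  have hle : x ≤ (t + 1) * x := le_mul_of_one_le_left hx.le (by simp)
  exact mul_exp_neg_sq_le_gaussWeight (by nlinarith [sq_nonneg ((t + 1) * x - 1)])

theorem gaussDominated_tailPrim₂ :
    GaussDominated fun t x => 2 / ((t : ℝ) + 1) ^ 2 * Real.exp (-((t + 1) * x) ^ 2) := by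
  obtain ⟨c, hc⟩ := gaussDominated_exp
  refine ⟨2 * c, fun t x hx => ?_⟩
  rw [abs_mul, abs_of_pos (by positivity), mul_assoc]
  gcongr
  · exact div_le_self zero_le_two (one_le_pow₀ (by simp))
  · exact hc t x hx

theorem hasDerivAt_exp_neg_sq (a x : ℝ) :
    HasDerivAt (fun x => Real.exp (-(a * x) ^ 2))
      (-(2 * a ^ 2 * x) * Real.exp (-(a * x) ^ 2)) x := by
  refine HasDerivAt.congr_deriv (((hasDerivAt_id' x).const_mul a).pow 2).neg.exp ?_
  simp only [Pi.neg_apply, Pi.pow_apply]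
  push_cast
  ring

theorem hasDerivAt_tailPrim {x : ℝ} (hx : 0 < x) : HasDerivAt tailPrim (limitTail x) x := by
  refine gaussDominated_gaussTerm.hasDerivAt_tsum gaussDominated_tailPrim (fun t x => ?_) hx
  refine HasDerivAt.congr_deriv
    (((hasDerivAt_id' x).const_mul 2).mul (hasDerivAt_exp_neg_sq (t + 1) x)).neg ?_
  rw [gaussTerm]
  ring

theorem hasDerivAt_tailPrim₂ {x : ℝ} (hx : 0 < x) :
    HasDerivAt tailPrim₂ (2 * tailPrim x) x := by
  rw [tailPrim, ← tsum_mul_left]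
  have hdom : GaussDominated fun t x => 2 * -(2 * x * Real.exp (-((t + 1) * x) ^ 2)) := by
    obtain ⟨c, hc⟩ := gaussDominated_tailPrim
    refine ⟨2 * c, fun t x hx => ?_⟩
    rw [abs_mul, abs_two, mul_assoc 2 c]
    exact mul_le_mul_of_nonneg_left (hc t x hx) zero_le_two
  refine hdom.hasDerivAt_tsum gaussDominated_tailPrim₂ (fun t x => ?_) hx
  refine ((hasDerivAt_exp_neg_sq (t + 1) x).const_mul (2 / ((t : ℝ) + 1) ^ 2)).congr_deriv ?_
  field_simp

theorem hasDerivAt_momentPrim {x : ℝ} (hx : 0 < x) :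
    HasDerivAt momentPrim (2 * x * limitTail x) x := by
  refine HasDerivAt.congr_deriv
    ((((hasDerivAt_id' x).const_mul 2).mul (hasDerivAt_tailPrim hx)).sub
      (hasDerivAt_tailPrim₂ hx)) ?_
  ring

theorem GaussDominated.tendsto_tsum {f : ℕ → ℝ → ℝ} (hf : GaussDominated f) :
    Tendsto (fun x => ∑' t, f t x) atTop (𝓝 0) :=
  (hf.isBigO_tsum one_lt_two).trans_tendsto (tendsto_rpow_neg_atTop two_pos)

theorem tendsto_limitTail_atTop : Tendsto limitTail atTop (𝓝 0) :=
  gaussDominated_gaussTerm.tendsto_tsum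

theorem tendsto_tailPrim_atTop : Tendsto tailPrim atTop (𝓝 0) :=
  gaussDominated_tailPrim.tendsto_tsum

theorem tendsto_momentPrim_atTop : Tendsto momentPrim atTop (𝓝 0) := by
  have hmul : Tendsto (fun x => x * tailPrim x) atTop (𝓝 0) := by
    have hO := (isBigO_refl id atTop).mul (gaussDominated_tailPrim.isBigO_tsum one_lt_two)
    refine hO.trans_tendsto ((tendsto_rpow_neg_atTop one_pos).congr' ?_)
    filter_upwards [eventually_gt_atTop 0] with x hx
    rw [id, ← Real.rpow_one_add' hx.le (by norm_num)]
    norm_num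
  have hsub := (hmul.const_mul 2).sub gaussDominated_tailPrim₂.tendsto_tsum
  rw [mul_zero, sub_zero] at hsub
  exact hsub.congr fun x => by rw [momentPrim, tailPrim₂, mul_assoc]

end Primitives

section Origin

theorem tsum_int_exp_neg_sq {c : ℝ} (hc : 0 < c) :
    ∑' t : ℤ, Real.exp (-(c * (t : ℝ)) ^ 2) = 1 + 2 * gaussSum c := by
  have hnat : Summable fun t : ℕ => Real.exp (-(c * (t : ℝ)) ^ 2) := by
    rw [← summable_nat_add_iff 1]
    refine (gaussDominated_exp.summable hc).congr fun t => ?_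
    rw [Nat.cast_succ, mul_comm c]
  have hint : Summable fun t : ℤ => Real.exp (-(c * (t : ℝ)) ^ 2) :=
    .of_nat_of_neg (by simpa using hnat) (by simpa using hnat)
  rw [tsum_int_of_even (fun t => by simp) hint, gaussSum]
  simp [mul_comm c]

/-- Jacobi's inversion formula for the theta function. -/
theorem tailPrim_eq_gaussSum_pi_div {x : ℝ} (hx : 0 < x) :
    tailPrim x = x - √π - 2 * √π * gaussSum (π / x) := by
  have hJ := Real.tsum_exp_neg_mul_int_sq (a := x ^ 2 / π) (by positivity)
  have hleft (t : ℤ) : -π * (x ^ 2 / π) * (t : ℝ) ^ 2 = -(x * (t : ℝ)) ^ 2 := by field_simp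
  have hright (t : ℤ) : -π / (x ^ 2 / π) * (t : ℝ) ^ 2 = -(π / x * (t : ℝ)) ^ 2 := by field_simp
  simp only [hleft, hright] at hJ
  rw [tsum_int_exp_neg_sq hx, tsum_int_exp_neg_sq (by positivity), ← Real.sqrt_eq_rpow,
    Real.sqrt_div (sq_nonneg x), Real.sqrt_sq hx.le, one_div_div, div_mul_eq_mul_div,
    eq_div_iff hx.ne'] at hJ
  rw [tailPrim, tsum_neg, tsum_mul_left, ← gaussSum]
  linarith

theorem isBigO_gaussSum_pi_div : (fun x => gaussSum (π / x)) =O[𝓝[>] 0] fun x => x := by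
  have hinv : Tendsto (fun x : ℝ => π / x) (𝓝[>] 0) atTop :=
    tendsto_inv_nhdsGT_zero.const_mul_atTop Real.pi_pos
  refine ((gaussDominated_exp.isBigO_tsum one_lt_two).comp_tendsto hinv).trans ?_
  refine IsBigO.of_bound 1 ?_
  filter_upwards [Ioo_mem_nhdsGT one_pos] with x hx
  have hπ : 1 ≤ π ^ 2 := one_le_pow₀ (by linarith [Real.pi_gt_three])
  have hpos : 0 ≤ π / x := div_nonneg Real.pi_pos.le hx.1.le
  rw [one_mul, Function.comp_apply, Real.norm_of_nonneg (Real.rpow_nonneg hpos _),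
    Real.norm_of_nonneg hx.1.le, Real.rpow_neg hpos, Real.rpow_two, ← inv_pow, inv_div, div_pow]
  exact (div_le_self (sq_nonneg x) hπ).trans (by nlinarith [hx.1, hx.2])

theorem isBigO_tailPrim_add_sqrt_pi : (fun x => tailPrim x + √π) =O[𝓝[>] 0] fun x => x := by
  refine ((isBigO_refl _ _).sub (isBigO_gaussSum_pi_div.const_mul_left (2 * √π))).congr' ?_ .rfl
  filter_upwards [self_mem_nhdsWithin] with x hx
  rw [tailPrim_eq_gaussSum_pi_div hx]
  ring

theorem one_sub_exp_neg_sq_le_sqrt {y : ℝ} (hy : 0 ≤ y) : 1 - Real.exp (-y ^ 2) ≤ √y := by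
  rcases le_total y 1 with h | h
  · calc 1 - Real.exp (-y ^ 2) ≤ y ^ 2 := by linarith [Real.one_sub_le_exp_neg (y ^ 2)]
      _ ≤ y := by nlinarith
      _ ≤ √y := Real.le_sqrt_self_iff.2 h
  · linarith [Real.one_le_sqrt.2 h, Real.exp_pos (-y ^ 2)]

theorem hasSum_two_div_succ_sq : HasSum (fun t : ℕ => 2 / ((t : ℝ) + 1) ^ 2) (π ^ 2 / 3) := by
  have hzeta := ((hasSum_nat_add_iff' 1).2 hasSum_zeta_two).mul_left 2
  rw [Finset.sum_range_one] at hzeta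
  have hterm : (fun t : ℕ => 2 / ((t : ℝ) + 1) ^ 2) =
      fun t : ℕ => 2 * (1 / ((t + 1 : ℕ) : ℝ) ^ 2) := by
    ext t
    push_cast
    ring
  have hvalue : π ^ 2 / 3 = 2 * (π ^ 2 / 6 - 1 / ((0 : ℕ) : ℝ) ^ 2) := by
    rw [Nat.cast_zero]
    ring
  rwa [hterm, hvalue]

theorem abs_tailPrim₂_term_sub_le (t : ℕ) {x : ℝ} (hx : 0 ≤ x) :
    |2 / ((t : ℝ) + 1) ^ 2 * Real.exp (-((t + 1) * x) ^ 2) - 2 / ((t : ℝ) + 1) ^ 2| ≤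
      2 * √x * ((t : ℝ) + 1) ^ (-(3 / 2) : ℝ) := by
  have ht : (0 : ℝ) < t + 1 := by positivity
  have hexp : Real.exp (-((t + 1) * x) ^ 2) ≤ 1 := by
    rw [Real.exp_le_one_iff, neg_nonpos]
    positivity
  have hpow : √((t : ℝ) + 1) / (t + 1) ^ 2 = ((t : ℝ) + 1) ^ (-(3 / 2) : ℝ) := by
    rw [Real.sqrt_eq_rpow, ← Real.rpow_natCast (_ + 1) 2, ← Real.rpow_sub ht]
    norm_num
  rw [← mul_sub_one, abs_mul, abs_of_pos (by positivity), abs_sub_comm,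
    abs_of_nonneg (sub_nonneg.2 hexp)]
  calc _ ≤ 2 / ((t : ℝ) + 1) ^ 2 * √((t + 1) * x) := by
        gcongr
        exact one_sub_exp_neg_sq_le_sqrt (by positivity)
    _ = _ := by
        rw [Real.sqrt_mul ht.le, ← hpow]
        ring

theorem isBigO_tailPrim₂_sub : (fun x => tailPrim₂ x - π ^ 2 / 3) =O[𝓝[>] 0] fun x => √x := by
  have hZ : Summable fun t : ℕ => ((t : ℝ) + 1) ^ (-(3 / 2) : ℝ) := summable_succ_rpow (by norm_num)
  refine IsBigO.of_bound (2 * ∑' t : ℕ, ((t : ℝ) + 1) ^ (-(3 / 2) : ℝ)) ?_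
  filter_upwards [self_mem_nhdsWithin] with x hx
  rw [Real.norm_of_nonneg (Real.sqrt_nonneg x), tailPrim₂, ← hasSum_two_div_succ_sq.tsum_eq,
    ← (gaussDominated_tailPrim₂.summable hx).tsum_sub hasSum_two_div_succ_sq.summable]
  refine (tsum_of_norm_bounded (hZ.mul_left (2 * √x)).hasSum
    fun t => abs_tailPrim₂_term_sub_le t (le_of_lt hx)).trans_eq ?_
  rw [tsum_mul_left]
  ring

theorem isBigO_id_sqrt : (fun x : ℝ => x) =O[𝓝[>] 0] fun x => √x := by
  refine IsBigO.of_bound 1 ?_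
  filter_upwards [Ioo_mem_nhdsGT one_pos] with x hx
  rw [one_mul, Real.norm_of_nonneg hx.1.le, Real.norm_of_nonneg (Real.sqrt_nonneg x)]
  exact Real.le_sqrt_self_iff.2 hx.2.le

theorem isBigO_momentPrim_add : (fun x => momentPrim x + π ^ 2 / 3) =O[𝓝[>] 0] fun x => √x := by
  have htail : tailPrim =O[𝓝[>] 0] fun _ => (1 : ℝ) := by
    have hid : (fun x : ℝ => x) =O[𝓝[>] 0] fun _ => (1 : ℝ) :=
      (tendsto_id.mono_left nhdsWithin_le_nhds).isBigO_one ℝ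
    simpa using (isBigO_tailPrim_add_sqrt_pi.trans hid).sub (isBigO_const_const √π one_ne_zero _)
  have hmul : (fun x => 2 * x * tailPrim x) =O[𝓝[>] 0] fun x => √x := by
    simpa using (isBigO_id_sqrt.const_mul_left 2).mul htail
  refine (hmul.sub isBigO_tailPrim₂_sub).congr_left fun x => ?_
  rw [momentPrim]
  ring

end Origin

section ThetaSum

theorem summable_thetaTerm {θ : ℝ} (hθ : -√π < θ) : Summable (thetaTerm θ) := by
  have hx : 0 < θ + √π := by linarith
  have hnat : Summable fun t : ℕ => thetaTerm θ (t : ℤ) := by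
    rw [← summable_nat_add_iff 1]
    refine ((gaussDominated_gaussTerm.summable hx).mul_left (-1 / 2)).congr fun t => ?_
    rw [gaussTerm, thetaTerm]
    push_cast
    ring_nf
  exact .of_nat_of_neg hnat (hnat.congr fun t => by simp [thetaTerm])

theorem tsum_thetaTerm {θ : ℝ} (hθ : -√π < θ) :
    ∑' t : ℤ, thetaTerm θ t = 1 - limitTail (θ + √π) := by
  rw [tsum_int_of_even (fun t => by simp [thetaTerm]) (summable_thetaTerm hθ), ← tsum_mul_left,
    limitTail, sub_eq_add_neg, ← tsum_neg]
  congr 1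
  · simp [thetaTerm]
  · refine tsum_congr fun t => ?_
    rw [gaussTerm, thetaTerm]
    push_cast
    ring_nf

end ThetaSum

section Distribution

theorem uniformOn_real_eq_ncard_div {Ω : Type*} [Finite Ω] [MeasurableSpace Ω]
    [MeasurableSingletonClass Ω] (s t : Set Ω) :
    (uniformOn s).real t = ((s ∩ t).ncard : ℝ) / s.ncard := by
  classical
  have := Fintype.ofFinite Ω
  have h := uniformOn_apply_finset (s := s.toFinset) (t := t.toFinset)
  rw [Set.coe_toFinset, Set.coe_toFinset] at h
  rw [measureReal_def, h, ENNReal.toReal_div, ENNReal.toReal_natCast, ENNReal.toReal_natCast,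
    Set.ncard_eq_toFinset_card', Set.ncard_eq_toFinset_card', Set.toFinset_inter]

theorem unif_real_lis_le (τ : Equiv.Perm (Fin 3)) (n k : ℕ) :
    (unif τ n).real {p | lis p ≤ k} = (numLe τ n k : ℝ) / numLe τ n n := by
  have hall : avoidersLe τ n n = avoiders τ n :=
    Set.ext fun p => and_iff_left (lis_le_size p)
  rw [unif, uniformOn_real_eq_ncard_div, numLe, numLe, hall]
  rfl

theorem numLe_pattern132 (n k : ℕ) : numLe pattern132 n k = numLe pattern213 n k := by
  rw [← revComp_pattern132, numLe_revComp]

variable {τ : Equiv.Perm (Fin 3)}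

theorem unif_real_lt_lis (hτ : τ = pattern132 ∨ τ = pattern213) (n k : ℕ) :
    (unif τ n).real {p | k < lis p} = lisTail n k := by
  have hnum (j : ℕ) : (numLe τ n j : ℝ) = catalan n * (1 - lisTail n j) := by
    rw [← numLe_eq_catalan_mul]
    rcases hτ with rfl | rfl
    · rw [numLe_pattern132]
    · rfl
  have hcompl : {p : Equiv.Perm (Fin n) | k < lis p} = {p | lis p ≤ k}ᶜ :=
    Set.ext fun p => (not_le (a := lis p)).symm
  have hcat : (catalan n : ℝ) ≠ 0 := by
    have h := n.centralBinom_ne_zero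
    rw [← succ_mul_catalan_eq_centralBinom] at h
    exact_mod_cast right_ne_zero_of_mul h
  rw [hcompl, probReal_compl_eq_one_sub .of_discrete, unif_real_lis_le, hnum, hnum,
    lisTail_eq_zero_of_le le_rfl, sub_zero, mul_one, mul_div_cancel_left₀ _ hcat, sub_sub_cancel]

theorem integral_sum_range_lis (hτ : τ = pattern132 ∨ τ = pattern213) (n : ℕ) (w : ℕ → ℝ) :
    ∫ p, ∑ k ∈ Finset.range (lis p), w k ∂(unif τ n) = ∑' k, w k * lisTail n k := by
  have hind (p : Equiv.Perm (Fin n)) : ∑ k ∈ Finset.range (lis p), w k =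
      ∑ k ∈ Finset.range n, Set.indicator {p | k < lis p} (fun _ => w k) p := by
    simp only [Set.indicator_apply, Set.mem_ofPred_eq]
    rw [← Finset.sum_filter]
    congr 1
    ext k
    have := lis_le_size p
    simp only [Finset.mem_range, Finset.mem_filter]
    omega
  have hterm (k : ℕ) : ∫ p, Set.indicator {p | k < lis p} (fun _ => w k) p ∂(unif τ n) =
      w k * lisTail n k := by
    rw [integral_indicator_const _ .of_discrete, unif_real_lt_lis hτ, smul_eq_mul, mul_comm]
  simp only [hind]
  rw [integral_finsetSum _ fun k _ => Integrable.of_finite, Finset.sum_congr rfl fun k _ => hterm k]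
  refine (tsum_eq_sum fun k hk => ?_).symm
  rw [lisTail_eq_zero_of_le (by simpa using hk), mul_zero]

theorem lisMean_eq_tsum (hτ : τ = pattern132 ∨ τ = pattern213) (n : ℕ) :
    lisMean τ n = ∑' k, lisTail n k := by
  simpa [lisMean] using integral_sum_range_lis hτ n fun _ => 1

theorem integral_lis_sq_eq_tsum (hτ : τ = pattern132 ∨ τ = pattern213) (n : ℕ) :
    ∫ p, (lis p : ℝ) ^ 2 ∂(unif τ n) = ∑' k : ℕ, (2 * (k : ℝ) + 1) * lisTail n k := by
  have hsq (m : ℕ) : (m : ℝ) ^ 2 = ∑ k ∈ Finset.range m, (2 * (k : ℝ) + 1) := by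
    induction m with
    | zero => simp
    | succ m ih =>
      rw [Finset.sum_range_succ, ← ih]
      push_cast
      ring
  simp only [hsq, integral_sum_range_lis hτ]

theorem normLIS_le_iff {n : ℕ} (hn : 0 < n) {θ : ℝ} (hθ : 0 ≤ θ + √π) (p : Equiv.Perm (Fin n)) :
    normLIS n p ≤ θ ↔ lis p ≤ ⌊(θ + √π) * √(n : ℝ)⌋₊ := by
  have hr : 0 < √(n : ℝ) := Real.sqrt_pos.2 (by exact_mod_cast hn)
  rw [normLIS, div_le_iff₀ hr, Nat.le_floor_iff (by positivity), Real.sqrt_mul Real.pi_pos.le,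
    add_mul, sub_le_iff_le_add]

theorem tendsto_mesh : Tendsto mesh atTop (𝓝[>] 0) :=
  tendsto_nhdsWithin_iff.2 ⟨(Real.tendsto_sqrt_atTop.comp
    (tendsto_atTop_add_const_right _ _ tendsto_natCast_atTop_atTop)).inv_tendsto_atTop,
    .of_forall mesh_pos⟩

theorem tendsto_sqrt_mul_mesh : Tendsto (fun n : ℕ => √(n : ℝ) * mesh n) atTop (𝓝 1) := by
  have h := (Real.continuous_sqrt.tendsto 1).comp (tendsto_natCast_div_add_atTop (1 : ℝ))
  rw [Real.sqrt_one] at h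
  refine h.congr fun n => ?_
  rw [Function.comp_apply, Real.sqrt_div n.cast_nonneg, mesh, div_eq_mul_inv]

theorem tendsto_floor_add_two_mul_mesh {x : ℝ} (hx : 0 ≤ x) :
    Tendsto (fun n : ℕ => ((⌊x * √(n : ℝ)⌋₊ : ℝ) + 2) * mesh n) atTop (𝓝 x) := by
  have hfloor := (tendsto_nat_floor_mul_div_atTop hx).comp
    (Real.tendsto_sqrt_atTop.comp tendsto_natCast_atTop_atTop)
  have h := (hfloor.mul tendsto_sqrt_mul_mesh).add
    ((tendsto_nhds_of_tendsto_nhdsWithin tendsto_mesh).const_mul 2)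
  rw [mul_one, mul_zero, add_zero] at h
  refine h.congr' ?_
  filter_upwards [eventually_gt_atTop 0] with n hn
  have hr : √(n : ℝ) ≠ 0 := (Real.sqrt_pos.2 (by exact_mod_cast hn)).ne'
  simp only [Function.comp_apply]
  field_simp

theorem tendsto_lisTail_floor {x : ℝ} (hx : 0 < x) :
    Tendsto (fun n : ℕ => lisTail n ⌊x * √(n : ℝ)⌋₊) atTop (𝓝 (limitTail x)) := by
  obtain ⟨C, hle⟩ := exists_abs_lisTail_sub_limitTail_le one_lt_two
  have hgrid := tendsto_floor_add_two_mul_mesh hx.le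
  have hbound := ((tendsto_nhds_of_tendsto_nhdsWithin tendsto_mesh).const_mul C).mul
    (hgrid.rpow_const (p := -2) (.inl hx.ne'))
  rw [mul_zero, zero_mul] at hbound
  simpa using (squeeze_zero_norm (fun n => hle n ⌊x * √(n : ℝ)⌋₊) hbound).add
    ((continuousAt_limitTail hx).tendsto.comp hgrid)

theorem tendsto_unif_real_normLIS_le (hτ : τ = pattern132 ∨ τ = pattern213) {θ : ℝ}
    (hθ : -√π < θ) : Tendsto (fun n : ℕ => (unif τ n).real {p | normLIS n p ≤ θ}) atTop
      (𝓝 (1 - limitTail (θ + √π))) := by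
  have hx : 0 < θ + √π := by linarith
  refine ((tendsto_lisTail_floor hx).const_sub 1).congr' ?_
  filter_upwards [eventually_gt_atTop 0] with n hn
  have hcompl : {p : Equiv.Perm (Fin n) | normLIS n p ≤ θ} =
      {p | ⌊(θ + √π) * √(n : ℝ)⌋₊ < lis p}ᶜ :=
    Set.ext fun p => (normLIS_le_iff hn hx.le p).trans not_lt.symm
  rw [hcompl, probReal_compl_eq_one_sub .of_discrete, unif_real_lt_lis hτ]

theorem limitTail_nonneg {x : ℝ} (hx : 0 < x) : 0 ≤ limitTail x :=
  ge_of_tendsto' (tendsto_lisTail_floor hx) fun n =>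
    unif_real_lt_lis (.inl rfl) n _ ▸ measureReal_nonneg

theorem limitTail_le_one {x : ℝ} (hx : 0 < x) : limitTail x ≤ 1 :=
  le_of_tendsto' (tendsto_lisTail_floor hx) fun n =>
    unif_real_lt_lis (.inl rfl) n _ ▸ measureReal_le_one

theorem antitoneOn_limitTail : AntitoneOn limitTail (Set.Ioi 0) := by
  intro x hx y hy hxy
  refine le_of_tendsto_of_tendsto' (tendsto_lisTail_floor hy) (tendsto_lisTail_floor hx) fun n => ?_
  rw [← unif_real_lt_lis (.inl rfl), ← unif_real_lt_lis (.inl rfl)]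
  refine measureReal_mono fun p hp => lt_of_le_of_lt (Nat.floor_mono ?_) hp
  gcongr

end Distribution

section RiemannSum

variable {F f w : ℝ → ℝ}

theorem hasSum_sub_of_monotoneOn (hF : MonotoneOn F (Set.Ioi 0)) (hlim : Tendsto F atTop (𝓝 0))
    {a h : ℝ} (ha : 0 < a) (hh : 0 < h) :
    HasSum (fun k : ℕ => F (a + (k + 1) * h) - F (a + k * h)) (-F a) := by
  have hgrid : Tendsto (fun k : ℕ => F (a + k * h)) atTop (𝓝 0) :=
    hlim.comp (tendsto_atTop_add_const_left _ _
      (tendsto_natCast_atTop_atTop.atTop_mul_const hh))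
  have hnonneg (k : ℕ) : 0 ≤ F (a + (k + 1) * h) - F (a + k * h) :=
    sub_nonneg.2 (hF (Set.mem_Ioi.2 (by positivity)) (Set.mem_Ioi.2 (by positivity)) (by linarith))
  rw [hasSum_iff_tendsto_nat_of_nonneg hnonneg]
  have hsum (m : ℕ) : ∑ k ∈ Finset.range m, (F (a + (k + 1) * h) - F (a + k * h)) =
      F (a + m * h) - F a := by
    simpa using Finset.sum_range_sub (fun k : ℕ => F (a + k * h)) m
  simpa only [hsum, zero_sub] using hgrid.sub_const (F a)

variable (hF : ∀ x > 0, HasDerivAt F (w x * f x) x) (hw : MonotoneOn w (Set.Ioi 0))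
  (hw0 : ∀ x > 0, 0 ≤ w x) (hf : AntitoneOn f (Set.Ioi 0)) (hf0 : ∀ x > 0, 0 ≤ f x)
  (hlim : Tendsto F atTop (𝓝 0))

include hF hw hw0 hf hf0

theorem sub_mem_Icc_of_hasDerivAt_mul {a b : ℝ} (ha : 0 < a) (hab : a < b) :
    F b - F a ∈ Set.Icc ((b - a) * (w a * f b)) ((b - a) * (w b * f a)) := by
  obtain ⟨c, ⟨hac, hcb⟩, hslope⟩ := exists_hasDerivAt_eq_slope F (fun x => w x * f x) hab
    (fun x hx => (hF x (ha.trans_le hx.1)).continuousAt.continuousWithinAt)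
    (fun x hx => hF x (ha.trans hx.1))
  have hc := ha.trans hac
  have hb := ha.trans hab
  have hba := sub_pos.2 hab
  rw [← (eq_div_iff hba.ne').1 hslope, mul_comm _ (b - a)]
  constructor <;> gcongr ?_ * ?_
  · exact mul_le_mul (hw ha hc hac.le) (hf hc hb hcb.le) (hf0 b hb) (hw0 c hc)
  · exact mul_le_mul (hw hc hb hcb.le) (hf ha hc hac.le) (hf0 c hc) (hw0 b hb)

theorem monotoneOn_of_hasDerivAt_mul : MonotoneOn F (Set.Ioi 0) := by
  intro a ha b hb hab
  rcases hab.eq_or_lt with rfl | hlt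
  · exact le_rfl
  · have hle := (sub_mem_Icc_of_hasDerivAt_mul hF hw hw0 hf hf0 ha hlt).1
    exact sub_nonneg.1 (hle.trans' (mul_nonneg (sub_nonneg.2 hab)
      (mul_nonneg (hw0 a ha) (hf0 b hb))))

include hlim

theorem mul_tsum_le_neg_primitive {a h : ℝ} (ha : 0 < a) (hh : 0 < h) :
    h * ∑' k : ℕ, w (a + k * h) * f (a + (k + 1) * h) ≤ -F a := by
  have hsum := hasSum_sub_of_monotoneOn (monotoneOn_of_hasDerivAt_mul hF hw hw0 hf hf0) hlim ha hh
  have hle (k : ℕ) : h * (w (a + k * h) * f (a + (k + 1) * h)) ≤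
      F (a + (k + 1) * h) - F (a + k * h) := by
    have hmem := sub_mem_Icc_of_hasDerivAt_mul hF hw hw0 hf hf0
      (show 0 < a + k * h by positivity) (show _ < a + (k + 1) * h by linarith)
    rw [add_sub_add_left_eq_sub, ← sub_mul, add_sub_cancel_left, one_mul] at hmem
    exact hmem.1
  have hnonneg (k : ℕ) : 0 ≤ h * (w (a + k * h) * f (a + (k + 1) * h)) :=
    mul_nonneg hh.le (mul_nonneg (hw0 _ (by positivity)) (hf0 _ (by positivity)))
  rw [← tsum_mul_left, ← hsum.tsum_eq]
  exact (hsum.summable.of_nonneg_of_le hnonneg hle).tsum_le_tsum hle hsum.summable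

theorem neg_primitive_le_mul_tsum {a h : ℝ} (ha : 0 < a) (hh : 0 < h)
    (hs : Summable fun k : ℕ => w (a + (k + 1) * h) * f (a + k * h)) :
    -F a ≤ h * ∑' k : ℕ, w (a + (k + 1) * h) * f (a + k * h) := by
  have hsum := hasSum_sub_of_monotoneOn (monotoneOn_of_hasDerivAt_mul hF hw hw0 hf hf0) hlim ha hh
  have hle (k : ℕ) : F (a + (k + 1) * h) - F (a + k * h) ≤
      h * (w (a + (k + 1) * h) * f (a + k * h)) := by
    have hmem := sub_mem_Icc_of_hasDerivAt_mul hF hw hw0 hf hf0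
      (show 0 < a + k * h by positivity) (show _ < a + (k + 1) * h by linarith)
    rw [add_sub_add_left_eq_sub, ← sub_mul, add_sub_cancel_left, one_mul] at hmem
    exact hmem.2
  rw [← tsum_mul_left, ← hsum.tsum_eq]
  exact hsum.summable.tsum_le_tsum hle (hs.mul_left h)

end RiemannSum

section LatticeTail

theorem summable_add_two_rpow {s : ℝ} (hs : 1 < s) :
    Summable fun k : ℕ => ((k : ℝ) + 2) ^ (-s) := by
  refine ((summable_nat_add_iff 1).2 (summable_succ_rpow hs)).congr fun k => ?_
  push_cast
  ring_nf

theorem pow_mul_mul_rpow {x h : ℝ} (hx : 0 < x) (hh : 0 < h) (q : ℕ) (s : ℝ) :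
    x ^ q * (x * h) ^ (-(q + s)) = h ^ (-(q + s)) * x ^ (-s) := by
  rw [Real.mul_rpow hx.le hh.le, ← mul_assoc, ← Real.rpow_natCast x, ← Real.rpow_add hx, mul_comm]
  ring_nf

variable {q : ℕ} {c : ℝ} {w : ℕ → ℝ} (hw : ∀ k : ℕ, |w k| ≤ c * ((k : ℝ) + 2) ^ q)
include hw

theorem summable_mul_limitTail {h : ℝ} (hh : 0 < h) :
    Summable fun k : ℕ => w k * limitTail ((k + 2) * h) := by
  obtain ⟨C, hle⟩ := gaussDominated_gaussTerm.exists_abs_tsum_le_rpow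
    (s := q + 2) (by linarith [q.cast_nonneg (α := ℝ)])
  refine .of_norm_bounded
    ((summable_add_two_rpow one_lt_two).mul_left (c * C * h ^ (-((q : ℝ) + 2)))) fun k => ?_
  have hk : (0 : ℝ) < k + 2 := by positivity
  calc ‖w k * limitTail ((k + 2) * h)‖
      ≤ c * ((k : ℝ) + 2) ^ q * (C * ((k + 2) * h) ^ (-((q : ℝ) + 2))) := by
        rw [norm_mul]
        exact mul_le_mul (hw k) (hle _ (by positivity)) (norm_nonneg _)
          ((abs_nonneg _).trans (hw k))
    _ = c * C * (((k : ℝ) + 2) ^ q * ((k + 2) * h) ^ (-((q : ℝ) + 2))) := by ring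
    _ = _ := by rw [pow_mul_mul_rpow hk hh, ← mul_assoc]

theorem isBigO_tsum_mul_lisTail_sub :
    (fun n => mesh n ^ (q + 1) * ∑' k : ℕ, w k * lisTail n k -
      mesh n ^ (q + 1) * ∑' k : ℕ, w k * limitTail ((k + 2) * mesh n)) =O[atTop]
      fun n => √(mesh n) := by
  obtain ⟨C, hle⟩ := exists_abs_lisTail_sub_limitTail_le
    (s := q + 3 / 2) (by linarith [q.cast_nonneg (α := ℝ)])
  refine .of_bound (c * C * ∑' k : ℕ, ((k : ℝ) + 2) ^ (-(3 / 2) : ℝ)) (.of_forall fun n => ?_)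
  have hh := mesh_pos n
  set h := mesh n
  have hscale : h ^ (q + 1) * (h * h ^ (-((q : ℝ) + 3 / 2))) = √h := by
    rw [← mul_assoc, ← pow_succ, ← Real.rpow_natCast, ← Real.rpow_add hh, Real.sqrt_eq_rpow]
    push_cast
    ring_nf
  have hterm (k : ℕ) : ‖w k * lisTail n k - w k * limitTail ((k + 2) * h)‖ ≤
      c * C * (h * h ^ (-((q : ℝ) + 3 / 2))) * ((k : ℝ) + 2) ^ (-(3 / 2) : ℝ) := by
    rw [← mul_sub, norm_mul]
    refine (mul_le_mul (hw k) (hle n k) (abs_nonneg _)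
      ((abs_nonneg _).trans (hw k))).trans_eq ?_
    have hpow := pow_mul_mul_rpow (show (0 : ℝ) < k + 2 by positivity) hh q (3 / 2)
    linear_combination c * C * h * hpow
  have hlis : Summable fun k => w k * lisTail n k :=
    summable_of_hasFiniteSupport <| (Set.finite_Iio n).subset fun k hk => by
      contrapose! hk
      simp [lisTail_eq_zero_of_le (not_lt.1 hk)]
  rw [← mul_sub, ← hlis.tsum_sub (summable_mul_limitTail hw hh), norm_mul,
    Real.norm_of_nonneg (by positivity), Real.norm_of_nonneg (Real.sqrt_nonneg h), ← hscale]
  refine (mul_le_mul_of_nonneg_left (tsum_of_norm_bounded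
    ((summable_add_two_rpow (by norm_num)).mul_left _).hasSum hterm) (by positivity)).trans_eq ?_
  rw [tsum_mul_left]
  ring

end LatticeTail

section Moments

theorem isBigO_of_eventually_mem_Icc {α : Type*} {l : Filter α} {a f b g : α → ℝ}
    (hf : ∀ᶠ x in l, f x ∈ Set.Icc (a x) (b x)) (ha : a =O[l] g) (hb : b =O[l] g) : f =O[l] g := by
  refine .trans (.of_bound 1 ?_) (ha.norm_left.add hb.norm_left)
  filter_upwards [hf] with x hx
  rw [one_mul]
  exact (abs_le_max_abs_abs hx.1 hx.2).trans (max_le_add_of_nonneg (abs_nonneg _) (abs_nonneg _))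
    |>.trans (le_abs_self _)

theorem tendsto_two_mul_nhdsGT_zero : Tendsto (fun x : ℝ => 2 * x) (𝓝[>] 0) (𝓝[>] 0) := by
  have h : Tendsto (fun x : ℝ => 2 * x) (𝓝 0) (𝓝 (2 * 0)) := tendsto_id.const_mul 2
  rw [mul_zero] at h
  exact tendsto_nhdsWithin_iff.2 ⟨h.mono_left nhdsWithin_le_nhds,
    eventually_mem_nhdsWithin.mono fun x hx => Set.mem_Ioi.2 (mul_pos two_pos hx)⟩

theorem mul_tsum_limitTail_mem_Icc {h : ℝ} (hh : 0 < h) :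
    h * ∑' k : ℕ, limitTail ((k + 2) * h) ∈ Set.Icc (-tailPrim (2 * h)) (-tailPrim h) := by
  have hderiv (x : ℝ) (hx : x > 0) : HasDerivAt tailPrim (1 * limitTail x) x := by
    simpa using hasDerivAt_tailPrim hx
  have hsummable := summable_mul_limitTail (w := fun _ => 1) (c := 1) (q := 0) (by simp) hh
  have hle := mul_tsum_le_neg_primitive hderiv (monotone_const.monotoneOn _)
    (fun _ _ => zero_le_one) antitoneOn_limitTail (fun _ => limitTail_nonneg)
    tendsto_tailPrim_atTop hh hh
  have hge := neg_primitive_le_mul_tsum hderiv (monotone_const.monotoneOn _)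
    (fun _ _ => zero_le_one) antitoneOn_limitTail (fun _ => limitTail_nonneg)
    tendsto_tailPrim_atTop (mul_pos two_pos hh) hh
    (hsummable.congr fun k => by ring_nf)
  have hupper (k : ℕ) : h + (k + 1) * h = (k + 2) * h := by ring
  have hlower (k : ℕ) : 2 * h + k * h = (k + 2) * h := by ring
  simp only [one_mul, hupper] at hle
  simp only [one_mul, hlower] at hge
  exact ⟨hge, hle⟩

theorem sq_mul_tsum_limitTail_mem_Icc {h : ℝ} (hh : 0 < h) :
    h ^ 2 * ∑' k : ℕ, (2 * (k : ℝ) + 1) * limitTail ((k + 2) * h) ∈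
      Set.Icc (-momentPrim (2 * h) - 5 * h * (h * ∑' k : ℕ, limitTail ((k + 2) * h)))
        (-momentPrim h - h * (h * ∑' k : ℕ, limitTail ((k + 2) * h))) := by
  have hmono : MonotoneOn (fun x : ℝ => 2 * x) (Set.Ioi 0) :=
    (monotone_id.const_mul zero_le_two).monotoneOn _
  have hs := summable_mul_limitTail (w := fun _ => 1) (c := 1) (q := 0) (by simp) hh
  have hs₁ := summable_mul_limitTail (w := fun k => 2 * k + 1) (c := 2) (q := 1)
    (fun k => by rw [abs_of_nonneg (by positivity)]; linarith) hh
  simp only [one_mul] at hs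
  have hweight (b : ℝ) (k : ℕ) : 2 * ((k + b) * h) * limitTail ((k + 2) * h) =
      h * ((2 * k + 1) * limitTail ((k + 2) * h)) +
        (2 * b - 1) * h * limitTail ((k + 2) * h) := by ring
  have hlinear (b : ℝ) : h * ∑' k : ℕ, 2 * ((k + b) * h) * limitTail ((k + 2) * h) =
      h ^ 2 * (∑' k : ℕ, (2 * (k : ℝ) + 1) * limitTail ((k + 2) * h)) +
        (2 * b - 1) * h * (h * ∑' k : ℕ, limitTail ((k + 2) * h)) := by
    simp_rw [hweight, (hs₁.mul_left h).tsum_add (hs.mul_left _), tsum_mul_left]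
    ring
  have hle := mul_tsum_le_neg_primitive (fun _ => hasDerivAt_momentPrim) hmono
    (fun x hx => by positivity) antitoneOn_limitTail (fun _ => limitTail_nonneg)
    tendsto_momentPrim_atTop hh hh
  have hge := neg_primitive_le_mul_tsum (fun _ => hasDerivAt_momentPrim) hmono
    (fun x hx => by positivity) antitoneOn_limitTail (fun _ => limitTail_nonneg)
    tendsto_momentPrim_atTop (mul_pos two_pos hh) hh
  have hnode₁ (k : ℕ) : h + k * h = (k + 1) * h := by ring
  have hnode₂ (k : ℕ) : h + (k + 1) * h = (k + 2) * h := by ring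
  have hnode₂' (k : ℕ) : 2 * h + k * h = (k + 2) * h := by ring
  have hnode₃ (k : ℕ) : 2 * h + (k + 1) * h = (k + 3) * h := by ring
  simp only [hnode₁, hnode₂, hlinear] at hle
  simp only [hnode₂', hnode₃, hlinear] at hge
  specialize hge (((hs₁.mul_left h).add (hs.mul_left _)).congr fun k => (hweight 3 k).symm)
  constructor <;> linarith

theorem isBigO_mul_tsum_limitTail_sub :
    (fun h : ℝ => h * ∑' k : ℕ, limitTail ((k + 2) * h) - √π) =O[𝓝[>] 0] fun h => h := by
  have hdouble : (fun h : ℝ => tailPrim (2 * h) + √π) =O[𝓝[>] 0] fun h => h :=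
    (isBigO_tailPrim_add_sqrt_pi.comp_tendsto tendsto_two_mul_nhdsGT_zero).trans
      (isBigO_const_mul_self 2 _ _)
  refine isBigO_of_eventually_mem_Icc ?_ hdouble.neg_left isBigO_tailPrim_add_sqrt_pi.neg_left
  filter_upwards [eventually_mem_nhdsWithin] with h hh
  have hmem := mul_tsum_limitTail_mem_Icc hh
  constructor <;> linarith [hmem.1, hmem.2]

theorem isBigO_sq_mul_tsum_limitTail_sub :
    (fun h : ℝ => h ^ 2 * ∑' k : ℕ, (2 * (k : ℝ) + 1) * limitTail ((k + 2) * h) - π ^ 2 / 3)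
      =O[𝓝[>] 0] fun h => √h := by
  have hsqrt : (fun h : ℝ => √(2 * h)) =O[𝓝[>] 0] fun h => √h := by
    simpa only [Real.sqrt_mul zero_le_two] using isBigO_const_mul_self √2 (fun h : ℝ => √h) _
  have hdouble : (fun h : ℝ => momentPrim (2 * h) + π ^ 2 / 3) =O[𝓝[>] 0] fun h => √h :=
    (isBigO_momentPrim_add.comp_tendsto tendsto_two_mul_nhdsGT_zero).trans hsqrt
  have hbounded : (fun h : ℝ => h * ∑' k : ℕ, limitTail ((k + 2) * h))
      =O[𝓝[>] 0] fun _ => (1 : ℝ) := by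
    have hid : (fun h : ℝ => h) =O[𝓝[>] 0] fun _ => (1 : ℝ) :=
      (tendsto_id.mono_left nhdsWithin_le_nhds).isBigO_one ℝ
    simpa using (isBigO_mul_tsum_limitTail_sub.trans hid).add (isBigO_const_const √π one_ne_zero _)
  have herror : (fun h : ℝ => h * (h * ∑' k : ℕ, limitTail ((k + 2) * h)))
      =O[𝓝[>] 0] fun h => √h := by simpa using isBigO_id_sqrt.mul hbounded
  refine isBigO_of_eventually_mem_Icc ?_ (hdouble.neg_left.sub (herror.const_mul_left 5))
    (isBigO_momentPrim_add.neg_left.sub herror)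
  filter_upwards [eventually_mem_nhdsWithin] with h hh
  have hmem := sq_mul_tsum_limitTail_mem_Icc hh
  constructor <;> linarith [hmem.1, hmem.2]

end Moments

section Asymptotics

theorem abs_sqrt_sub_sqrt_le {a b : ℝ} (ha : 0 ≤ a) (hb : 0 < b) :
    |√a - √b| ≤ (√b)⁻¹ * |a - b| := by
  have hsum : 0 < √a + √b := add_pos_of_nonneg_of_pos (Real.sqrt_nonneg a) (Real.sqrt_pos.2 hb)
  have hdiff : a - b = (√a + √b) * (√a - √b) := by
    rw [← sq_sub_sq, Real.sq_sqrt ha, Real.sq_sqrt hb.le]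
  rw [hdiff, abs_mul, abs_of_pos hsum, ← mul_assoc]
  refine le_mul_of_one_le_left (abs_nonneg _) ?_
  rw [inv_mul_eq_div, one_le_div (Real.sqrt_pos.2 hb)]
  exact le_add_of_nonneg_left (Real.sqrt_nonneg a)

theorem isBigO_inv_mesh_mul_sqrt_mesh :
    (fun n => (mesh n)⁻¹ * √(mesh n)) =O[atTop] fun n : ℕ => (n : ℝ) ^ (1 / 4 : ℝ) := by
  refine .of_bound (2 ^ (1 / 4 : ℝ)) (eventually_atTop.2 ⟨1, fun n hn => ?_⟩)
  have hn' : (1 : ℝ) ≤ n := by exact_mod_cast hn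
  have hpow : (mesh n)⁻¹ * √(mesh n) = ((n : ℝ) + 1) ^ (1 / 4 : ℝ) := by
    rw [mesh, inv_inv, Real.sqrt_inv, ← div_eq_mul_inv, Real.div_sqrt, Real.sqrt_eq_rpow,
      Real.sqrt_eq_rpow, ← Real.rpow_mul (by positivity)]
    norm_num
  rw [hpow, Real.norm_of_nonneg (by positivity), Real.norm_of_nonneg (by positivity),
    ← Real.mul_rpow zero_le_two n.cast_nonneg]
  gcongr
  linarith

theorem isBigO_inv_mesh_sub_sqrt :
    (fun n : ℕ => (mesh n)⁻¹ - √(n : ℝ)) =O[atTop] fun _ => (1 : ℝ) := by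
  refine .of_bound 1 (.of_forall fun n => ?_)
  have hle : √(n : ℝ) ≤ √(n + 1) := Real.sqrt_le_sqrt (by linarith)
  have hge : √((n : ℝ) + 1) ≤ √n + 1 := Real.sqrt_le_iff.2
    ⟨by positivity, by nlinarith [Real.sq_sqrt (n.cast_nonneg (α := ℝ)), Real.sqrt_nonneg (n : ℝ)]⟩
  rw [mesh, inv_inv, Real.norm_of_nonneg (sub_nonneg.2 hle), norm_one]
  linarith

theorem isBigO_sub_mul_sqrt_of_mesh_mul {a : ℕ → ℝ} {c : ℝ}
    (h : (fun n => mesh n * a n - c) =O[atTop] fun n => √(mesh n)) :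
    (fun n => a n - c * √(n : ℝ)) =O[atTop] fun n : ℕ => (n : ℝ) ^ (1 / 4 : ℝ) := by
  have hone : (fun _ => (1 : ℝ)) =O[atTop] fun n : ℕ => (n : ℝ) ^ (1 / 4 : ℝ) := by
    refine .of_bound 1 (eventually_atTop.2 ⟨1, fun n hn => ?_⟩)
    have hpow : (1 : ℝ) ≤ (n : ℝ) ^ (1 / 4 : ℝ) :=
      Real.one_le_rpow (by exact_mod_cast hn) (by norm_num)
    rwa [norm_one, one_mul, Real.norm_of_nonneg (by positivity)]
  refine ((((isBigO_refl (fun n => (mesh n)⁻¹) _).mul h).trans isBigO_inv_mesh_mul_sqrt_mesh).add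
    ((isBigO_inv_mesh_sub_sqrt.trans hone).const_mul_left c)).congr_left fun n => ?_
  have := (mesh_pos n).ne'
  field_simp
  ring

variable {τ : Equiv.Perm (Fin 3)} (hτ : τ = pattern132 ∨ τ = pattern213)
include hτ

theorem isBigO_mesh_mul_lisMean_sub :
    (fun n => mesh n * lisMean τ n - √π) =O[atTop] fun n => √(mesh n) := by
  have hlattice := isBigO_tsum_mul_lisTail_sub (w := fun _ => 1) (c := 1) (q := 0) (by simp)
  have hriemann := (isBigO_mul_tsum_limitTail_sub.trans isBigO_id_sqrt).comp_tendsto tendsto_mesh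
  simpa [Function.comp_def, lisMean_eq_tsum hτ] using hlattice.add hriemann

theorem isBigO_mesh_sq_mul_integral_lis_sq_sub :
    (fun n => mesh n ^ 2 * ∫ p, (lis p : ℝ) ^ 2 ∂unif τ n - π ^ 2 / 3) =O[atTop]
      fun n => √(mesh n) := by
  have hlattice := isBigO_tsum_mul_lisTail_sub (w := fun k => 2 * k + 1) (c := 2) (q := 1)
    (fun k => by rw [abs_of_nonneg (by positivity)]; linarith)
  have hriemann := isBigO_sq_mul_tsum_limitTail_sub.comp_tendsto tendsto_mesh
  simpa [Function.comp_def, integral_lis_sq_eq_tsum hτ] using hlattice.add hriemann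

theorem isBigO_mesh_sq_mul_variance_sub :
    (fun n => mesh n ^ 2 * variance (fun p => (lis p : ℝ)) (unif τ n) - π * (π / 3 - 1)) =O[atTop]
      fun n => √(mesh n) := by
  have hmean := isBigO_mesh_mul_lisMean_sub hτ
  have hsqrt : (fun n => √(mesh n)) =O[atTop] fun _ => (1 : ℝ) := by
    have hlim := (Real.continuous_sqrt.tendsto 0).comp (tendsto_mesh.mono_right nhdsWithin_le_nhds)
    exact hlim.isBigO_one ℝ
  have hconj : (fun n => mesh n * lisMean τ n + √π) =O[atTop] fun _ => (1 : ℝ) := by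
    refine ((hmean.trans hsqrt).add (isBigO_const_const (2 * √π) one_ne_zero _)).congr_left
      fun n => ?_
    ring
  have hsquare : (fun n => (mesh n * lisMean τ n - √π) * (mesh n * lisMean τ n + √π))
      =O[atTop] fun n => √(mesh n) := by simpa using hmean.mul hconj
  refine ((isBigO_mesh_sq_mul_integral_lis_sq_sub hτ).sub hsquare).congr_left fun n => ?_
  rw [variance_eq_sub .of_discrete, ← lisMean]
  simp only [Pi.pow_apply]
  linear_combination Real.sq_sqrt Real.pi_nonneg

theorem isBigO_mesh_mul_lisSD_sub :
    (fun n => mesh n * lisSD τ n - √(π * (π / 3 - 1))) =O[atTop] fun n => √(mesh n) := by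
  have hpos : 0 < π * (π / 3 - 1) := mul_pos Real.pi_pos (by linarith [Real.pi_gt_three])
  refine .trans (.of_bound (√(π * (π / 3 - 1)))⁻¹ (.of_forall fun n => ?_))
    (isBigO_mesh_sq_mul_variance_sub hτ)
  rw [lisSD, ← Real.sqrt_sq (mesh_pos n).le, ← Real.sqrt_mul (sq_nonneg _),
    Real.sq_sqrt (sq_nonneg _)]
  exact abs_sqrt_sub_sqrt_le (mul_nonneg (sq_nonneg _) (variance_nonneg _ _)) hpos

theorem isBigO_lisMean_sub :
    (fun n => lisMean τ n - √(π * n)) =O[atTop] fun n : ℕ => (n : ℝ) ^ (1 / 4 : ℝ) := by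
  simpa only [Real.sqrt_mul Real.pi_nonneg] using
    isBigO_sub_mul_sqrt_of_mesh_mul (isBigO_mesh_mul_lisMean_sub hτ)

theorem isBigO_lisSD_sub :
    (fun n => lisSD τ n - √(π * (π / 3 - 1)) * √(n : ℝ)) =O[atTop]
      fun n : ℕ => (n : ℝ) ^ (1 / 4 : ℝ) :=
  isBigO_sub_mul_sqrt_of_mesh_mul (isBigO_mesh_mul_lisSD_sub hτ)

end Asymptotics

section WeakConvergence

theorem tendsto_probabilityMeasure_of_tendsto_cdf {ι : Type*} {l : Filter ι}
    [l.IsCountablyGenerated] {μ : ι → ProbabilityMeasure ℝ} {ν : ProbabilityMeasure ℝ} {D : Set ℝ}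
    (hD : Dense D)
    (h : ∀ x ∈ D, Tendsto (fun i => cdf (μ i : Measure ℝ) x) l (𝓝 (cdf (ν : Measure ℝ) x))) :
    Tendsto μ l (𝓝 ν) := by
  refine (isPiSystem_Ioc_mem D D).tendsto_probabilityMeasure_of_tendsto_of_mem ?_ ?_ ?_
  · rintro _ ⟨a, -, b, -, -, rfl⟩
    exact measurableSet_Ioc
  · intro u hu x hx
    obtain ⟨l, r, ⟨hlx, hxr⟩, hsub⟩ := mem_nhds_iff_exists_Ioo_subset.1 (hu.mem_nhds hx)
    obtain ⟨a, ha, hla, hax⟩ := hD.exists_between hlx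
    obtain ⟨b, hb, hxb, hbr⟩ := hD.exists_between hxr
    exact ⟨Set.Ioc a b, ⟨a, ha, b, hb, hax.trans hxb, rfl⟩, Ioc_mem_nhds hax hxb,
      fun y hy => hsub ⟨hla.trans hy.1, hy.2.trans_lt hbr⟩⟩
  · rintro _ ⟨a, ha, b, hb, hab, rfl⟩
    have hIoc (ρ : ProbabilityMeasure ℝ) :
        ((ρ (Set.Ioc a b) : NNReal) : ℝ) = cdf (ρ : Measure ℝ) b - cdf (ρ : Measure ℝ) a := by
      rw [cdf_eq_real, cdf_eq_real, ← measureReal_sdiff (Set.Iic_subset_Iic.2 hab.le)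
        measurableSet_Iic, Set.Iic_sdiff_Iic]
      rfl
    rw [← NNReal.tendsto_coe]
    simpa only [hIoc] using (h b hb).sub (h a ha)

end WeakConvergence

section LimitLaw

/-- The limiting distribution function of the normalized length of the longest increasing
subsequence, except that its value at `-√π` is set to `0`. -/
noncomputable def limitCDF : ℝ → ℝ :=
  (Set.Ioi (-√π)).indicator fun x => 1 - limitTail (x + √π)

theorem limitCDF_of_le {x : ℝ} (hx : x ≤ -√π) : limitCDF x = 0 :=
  Set.indicator_of_notMem (Set.notMem_Ioi.2 hx) _

theorem limitCDF_of_gt {x : ℝ} (hx : -√π < x) : limitCDF x = 1 - limitTail (x + √π) :=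
  Set.indicator_of_mem (Set.mem_Ioi.2 hx) _

theorem monotone_limitCDF : Monotone limitCDF := by
  intro x y hxy
  rcases le_or_gt x (-√π) with hx | hx
  · rw [limitCDF_of_le hx]
    exact Set.indicator_nonneg
      (fun z hz => sub_nonneg.2 (limitTail_le_one (neg_lt_iff_pos_add.1 hz))) y
  · rw [limitCDF_of_gt hx, limitCDF_of_gt (hx.trans_le hxy)]
    exact sub_le_sub_left (antitoneOn_limitTail (neg_lt_iff_pos_add.1 hx)
      (neg_lt_iff_pos_add.1 (hx.trans_le hxy)) (by gcongr)) 1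

theorem continuousAt_limitCDF {x : ℝ} (hx : x ≠ -√π) : ContinuousAt limitCDF x := by
  rcases hx.lt_or_gt with hx | hx
  · exact (continuousAt_const (y := (0 : ℝ))).congr
      ((eventually_lt_nhds hx).mono fun y hy => (limitCDF_of_le hy.le).symm)
  · have hadd : ContinuousAt (fun y : ℝ => y + √π) x := by fun_prop
    have htail := (continuousAt_limitTail (neg_lt_iff_pos_add.1 hx)).comp_of_eq hadd rfl
    exact (continuousAt_const.sub htail).congr
      ((eventually_gt_nhds hx).mono fun y hy => (limitCDF_of_gt hy).symm)

/-- The right-continuous version of `limitCDF`. -/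
noncomputable def limitStieltjes : StieltjesFunction ℝ := monotone_limitCDF.stieltjesFunction

theorem limitStieltjes_eq {x : ℝ} (hx : x ≠ -√π) : limitStieltjes x = limitCDF x := by
  rw [limitStieltjes, Monotone.stieltjesFunction_eq]
  exact (continuousAt_limitCDF hx).continuousWithinAt.rightLim_eq

theorem limitStieltjes_of_lt {x : ℝ} (hx : x < -√π) : limitStieltjes x = 0 := by
  rw [limitStieltjes_eq hx.ne, limitCDF_of_le hx.le]

theorem limitStieltjes_of_gt {x : ℝ} (hx : -√π < x) :
    limitStieltjes x = 1 - limitTail (x + √π) := by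
  rw [limitStieltjes_eq hx.ne', limitCDF_of_gt hx]

theorem tendsto_limitStieltjes_atBot : Tendsto limitStieltjes atBot (𝓝 0) :=
  tendsto_const_nhds.congr'
    ((eventually_lt_atBot _).mono fun _ hx => (limitStieltjes_of_lt hx).symm)

theorem tendsto_limitStieltjes_atTop : Tendsto limitStieltjes atTop (𝓝 1) := by
  have h := (tendsto_limitTail_atTop.comp
    (tendsto_atTop_add_const_right atTop √π tendsto_id)).const_sub 1
  rw [sub_zero] at h
  exact h.congr' ((eventually_gt_atTop _).mono fun _ hx => (limitStieltjes_of_gt hx).symm)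

/-- The limiting law of the normalized length of the longest increasing subsequence. -/
noncomputable def limitLaw : ProbabilityMeasure ℝ :=
  ⟨limitStieltjes.measure,
    limitStieltjes.isProbabilityMeasure tendsto_limitStieltjes_atBot tendsto_limitStieltjes_atTop⟩

theorem cdf_limitLaw : cdf (limitLaw : Measure ℝ) = limitStieltjes :=
  cdf_measure_stieltjesFunction _ tendsto_limitStieltjes_atBot tendsto_limitStieltjes_atTop

theorem cdf_limitLaw_eq_tsum_thetaTerm {θ : ℝ} (hθ : -√π < θ) :
    cdf (limitLaw : Measure ℝ) θ = ∑' t : ℤ, thetaTerm θ t := by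
  rw [cdf_limitLaw, limitStieltjes_of_gt hθ, tsum_thetaTerm hθ]

theorem limitLaw_Iio : (limitLaw : Measure ℝ) (Set.Iio (-√π)) = 0 := by
  refine (limitStieltjes.measure_Iio tendsto_limitStieltjes_atBot (-√π)).trans ?_
  have hleft : Tendsto limitStieltjes (𝓝[<] (-√π)) (𝓝 0) := tendsto_const_nhds.congr'
    (eventually_mem_nhdsWithin.mono fun _ hx => (limitStieltjes_of_lt hx).symm)
  rw [leftLim_eq_of_tendsto hleft, sub_zero, ENNReal.ofReal_zero]

end LimitLaw

section ConvergenceInDistribution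

theorem neg_sqrt_pi_le_normLIS {n : ℕ} (hn : 0 < n) (p : Equiv.Perm (Fin n)) :
    -√π ≤ normLIS n p := by
  have hr : 0 < √(n : ℝ) := Real.sqrt_pos.2 (by exact_mod_cast hn)
  rw [normLIS, le_div_iff₀ hr, Real.sqrt_mul Real.pi_nonneg, neg_mul, neg_le_sub_iff_le_add]
  exact le_add_of_nonneg_left (lis p).cast_nonneg

variable {τ : Equiv.Perm (Fin 3)} (hτ : τ = pattern132 ∨ τ = pattern213)
include hτ

theorem tendsto_unif_real_normLIS_le_limitStieltjes {x : ℝ} (hx : x ≠ -√π) :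
    Tendsto (fun n => (unif τ n).real {p | normLIS n p ≤ x}) atTop (𝓝 (limitStieltjes x)) := by
  rcases hx.lt_or_gt with hx | hx
  · rw [limitStieltjes_of_lt hx]
    refine tendsto_const_nhds.congr' ((eventually_gt_atTop 0).mono fun n hn => ?_)
    have hempty : {p : Equiv.Perm (Fin n) | normLIS n p ≤ x} = ∅ :=
      Set.eq_empty_of_forall_notMem fun p hp =>
        (hx.trans_le (neg_sqrt_pi_le_normLIS hn p)).not_ge hp
    simp only [hempty, measureReal_empty]
  · rw [limitStieltjes_of_gt hx]
    exact tendsto_unif_real_normLIS_le hτ hx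

theorem tendstoInDistribution_normLIS :
    TendstoInDistribution normLIS atTop (id : ℝ → ℝ) (unif τ) (limitLaw : Measure ℝ) := by
  refine ⟨fun n => Measurable.of_discrete.aemeasurable, aemeasurable_id, ?_⟩
  refine tendsto_probabilityMeasure_of_tendsto_cdf (dense_compl_singleton (-√π)) fun x hx => ?_
  have hcdf (n : ℕ) : cdf ((unif τ n).map (normLIS n)) x =
      (unif τ n).real {p | normLIS n p ≤ x} := by
    have := Measure.isProbabilityMeasure_map (μ := unif τ n)
      (Measurable.of_discrete (f := normLIS n)).aemeasurable
    rw [cdf_eq_real, map_measureReal_apply .of_discrete measurableSet_Iic]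
    rfl
  simpa only [ProbabilityMeasure.coe_mk, hcdf, Measure.map_id, cdf_limitLaw] using
    tendsto_unif_real_normLIS_le_limitStieltjes hτ hx

end ConvergenceInDistribution

end PatternLIS

theorem theorem2 (τ : Equiv.Perm (Fin 3))
    (hτ : τ = PatternLIS.pattern132 ∨ τ = PatternLIS.pattern213) :
    ((fun n : ℕ => PatternLIS.lisMean τ n - √(π * n)) =O[atTop]
      fun n : ℕ => (n : ℝ) ^ (1 / 4 : ℝ)) ∧
    ((fun n : ℕ => PatternLIS.lisSD τ n - √(π * (π / 3 - 1)) * √(n : ℝ)) =O[atTop]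
      fun n : ℕ => (n : ℝ) ^ (1 / 4 : ℝ)) ∧
    (∀ θ : ℝ, -√π < θ →
      Summable (PatternLIS.thetaTerm θ) ∧
      Tendsto (fun n : ℕ => (PatternLIS.unif τ n).real {p | PatternLIS.normLIS n p ≤ θ}) atTop
        (𝓝 (∑' t : ℤ, PatternLIS.thetaTerm θ t))) ∧
    ∃ ν : ProbabilityMeasure ℝ,
      (ν : Measure ℝ) (Set.Iio (-√π)) = 0 ∧
      (∀ θ : ℝ, -√π < θ → cdf (ν : Measure ℝ) θ = ∑' t : ℤ, PatternLIS.thetaTerm θ t) ∧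
      TendstoInDistribution PatternLIS.normLIS atTop (id : ℝ → ℝ)
        (PatternLIS.unif τ) (ν : Measure ℝ) := by
  refine ⟨PatternLIS.isBigO_lisMean_sub hτ, PatternLIS.isBigO_lisSD_sub hτ,
    fun θ hθ => ⟨PatternLIS.summable_thetaTerm hθ, ?_⟩, PatternLIS.limitLaw,
    PatternLIS.limitLaw_Iio, fun θ hθ => PatternLIS.cdf_limitLaw_eq_tsum_thetaTerm hθ,
    PatternLIS.tendstoInDistribution_normLIS hτ⟩
  rw [PatternLIS.tsum_thetaTerm hθ]
  exact PatternLIS.tendsto_unif_real_normLIS_le hτ hθ
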